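/- **Setting.** Let $E=\mathbb R^d$, let $k:E\times E\to[0,1]$ be a kernel, $n\in\mathbb N$ and $R\in\mathbb R$. A *hash family* is a collection $\mathcal H$ of functions on $E$ with a probability law $\nu$ (all collision events $\{h(x)=h(y)\}$ measurable); its collision probability is $p(x,y)=\mathbb P_{h\sim\nu}[h(x)=h(y)]$. For a finite nonempty set $Q\subset E$, a query $q\in E$ and $h\sim\nu$ let $H(q)=\{y\in Q: h(y)=h(q)\}$ and let $I$ be a uniformly random element of $H(q)$ (independent randomness). The *hashing-based estimator* (HBE) is $Z_h(q)=\frac1{|Q|}\frac{k(q,I)}{p(q,I)}|H(q)|$, and $Z_h(q)=0$ if $H(q)=\emptyset$. Put $\mu_Q(q)=\frac1{|Q|}\sum_{y\in Q}k(q,y)$. For a function $V$ that is nonnegative and non-increasing on $(0,1]$ and for which $\mu^2V(\mu)$ is non-decreasing on $(0,1]$, the HBE is *$V$-bounded* if $\mathbb E[Z_h(q)]=\mu_Q(q)$ and $\mathbb E[Z_h(q)^2]\le\mu_Q(q)^2\,V(\mu_Q(q))$ for all $Q$ with $1\le|Q|\le n$ and all $q$ with $\operatorname{diam}(Q\cup\{q\})\le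 R$. It has *complexity* $T$ (an integer $T\ge1$) if sampling $h$ and forming its hash table on $m$ points takes time and space at most $Tm$, and evaluating the estimator (returning $I$ and $Z_h(q)$) takes time at most $T$. **Model.** Algorithms are programs of a randomized real RAM: arrays of naturals and of reals, unit-cost reads, writes, comparisons, additions and truncated subtractions of naturals, field operations on reals, conversion of naturals to reals, and evaluations of $V$; no rounding of reals to integers. The points are accessed only by the two HBE operations, with the costs above and fresh independent randomness in each. The input is $n,z,\varepsilon,\tau$. Space is the number of memory cells used (input included) plus $Tm$ for each hash table on $m$ points. **Theorem.** There are a program and constants $C,c$ such that, for all $d,n,R,k$, every $V$-bounded HBE for $k$ (as above) of complexity $T$, every dataset $P=\{x_1,\dots,x_n\}\subset\mathbb R^d$ of $n$ distinct points with $\operatorname{diam}P\le R$, every $z\in\mathbb R^n$ with $z\ge0$ and $\|z\|_1=1$, and all $\varepsilon,\tau\in(0,1]$, the following holds with $K=(k(x_i,x_j))_{i,j\le n}$ and $y=Kz$. The program always halts, after time at most $$C\,\Big(\log\frac{2n}{\varepsilon\tau}\Big)^{c}\cdot\frac1{\varepsilon^2}\max\{1,V(\varepsilon\tau)\}\cdot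 nT=\tilde O\Big(\frac1{\varepsilon^2}V(\varepsilon\tau)\cdot nT\Big)$$ (the last form when $V(\varepsilon\tau)\ge1$) and using space at most the same bound, and with probability at least $1-1/n$ its output $\hat y\in\mathbb R^n$ satisfies $$|\hat y_i-y_i|\le3\varepsilon\tau+\varepsilon|y_i|\quad\text{for all }i\in\{1,\dots,n\},$$ and $$\|\hat y-y\|_p\le\varepsilon\big(3\tau n^{1/p}+\|y\|_p\big)\quad\text{for all real }p\ge1.$$ -/

import Mathlib

/-!
Hashing-based estimators and a randomized real RAM with access to such an estimator.
-/

namespace HBE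

open MeasureTheory

universe u v w

/-! ## Hash families and hashing-based estimators -/

/-- A family of hash functions on `E` together with a probability law on it. -/
structure HashFamily (E : Type w) where
  /-- the (index set of the) collection of hash functions -/
  Fn : Type u
  [meas : MeasurableSpace Fn]
  /-- the distribution from which a hash function is sampled -/
  law : Measure Fn
  [prob : IsProbabilityMeasure law]
  /-- the hash values -/
  Bucket : Type v
  hash : Fn → E → Bucket
  measurableSet_collision : ∀ x y : E, MeasurableSet {h | hash h x = hash h y}

attribute [instance] HashFamily.meas HashFamily.prob

namespace HashFamily

variable {E : Type w} (F : HashFamily.{u, v, w} E) {ι : Type*}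

/-- The collision probability `p(x, y)` of two points. -/
noncomputable def collisionProb (x y : E) : ℝ :=
  F.law.real {h | F.hash h x = F.hash h y}

open Classical in
/-- The cell `H(q)`: the elements of the dataset (a list `S` of labels, the point with label `j`
being `pt j`) that have the same hash value as the query `q`. -/
noncomputable def cell (pt : ι → E) (S : List ι) (h : F.Fn) (q : E) : List ι :=
  S.filter fun j => F.hash h (pt j) = F.hash h q

/-- The random element `I(q)` of the cell `H(q)`, and `none` if the cell is empty: for `r` uniform
in `[0, 1]`, the entry at position `⌊r · |H(q)|⌋` is uniform in `H(q)`
(`r = 1` is a null event). -/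
noncomputable def draw (pt : ι → E) (S : List ι) (h : F.Fn) (r : unitInterval) (q : E) :
    Option ι :=
  (F.cell pt S h q)[⌊(r : ℝ) * (F.cell pt S h q).length⌋₊]?

/-- The hashing-based estimator `Z_h(q) = (1 / |S|) · k(q, I) / p(q, I) · |H(q)|` with
`I = I(q)`, and `0` if the cell is empty. -/
noncomputable def estimate (k : E → E → ℝ) (pt : ι → E) (S : List ι) (h : F.Fn)
    (r : unitInterval) (q : E) : ℝ :=
  (F.draw pt S h r q).elim 0 fun j =>
    k q (pt j) / F.collisionProb q (pt j) * ((F.cell pt S h q).length / S.length)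

/-- The law of an infinite sequence of independent pairs (hash function drawn from the law of
the family, uniform number in `[0, 1]`). -/
noncomputable def tapeLaw : Measure (ℕ → F.Fn × unitInterval) :=
  Measure.infinitePi fun _ => F.law.prod (volume : Measure unitInterval)

end HashFamily

/-- The kernel density `μ(q) = (1 / |Q|) ∑_{y ∈ Q} k(q, y)` of a dataset. -/
noncomputable def density {E : Type w} (k : E → E → ℝ) (Q : List E) (q : E) : ℝ :=
  (Q.map (k q)).sum / Q.length

/-- The hashing-based estimator that the family `F` gives for the kernel `k` is unbiased and
`V`-bounded, for all datasets `Q` of at most `n` distinct points and all queries `q` such that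
`Q ∪ {q}` has diameter at most `R`. -/
structure VBounded {E : Type w} [PseudoMetricSpace E] (F : HashFamily.{u, v, w} E)
    (k : E → E → ℝ) (V : ℝ → ℝ) (R : ℝ) (n : ℕ) : Prop where
  nonneg : ∀ μ ∈ Set.Ioc (0 : ℝ) 1, 0 ≤ V μ
  antitone : AntitoneOn V (Set.Ioc 0 1)
  monotone : MonotoneOn (fun μ => μ ^ 2 * V μ) (Set.Ioc 0 1)
  unbiased : ∀ Q : List E, Q ≠ [] → Q.Nodup → Q.length ≤ n → ∀ q : E,
    Metric.diam (insert q {y | y ∈ Q}) ≤ R →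
      ∫ ω, F.estimate k id Q ω.1 ω.2 q ∂(F.law.prod (volume : Measure unitInterval))
        = density k Q q
  second_moment : ∀ Q : List E, Q ≠ [] → Q.Nodup → Q.length ≤ n → ∀ q : E,
    Metric.diam (insert q {y | y ∈ Q}) ≤ R →
      ∫ ω, F.estimate k id Q ω.1 ω.2 q ^ 2 ∂(F.law.prod (volume : Measure unitInterval))
        ≤ density k Q q ^ 2 * V (density k Q q)

/-! ## The machine

A random access machine whose memory consists of arrays of natural numbers and arrays of real
numbers. Arithmetic and comparisons of numbers, reads, writes and evaluations of the function `V`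
take unit time. There is no rounding of reals to integers. The dataset is accessed
only through the hashing-based estimator: forming the hash table of a freshly sampled hash function
on `m` points takes time and space `T · m`, and evaluating the estimator at a query takes time `T`. -/

/-- Expressions with values in `ℕ`. -/
inductive NExp where
  | lit (c : ℕ)
  /-- entry of an array of naturals -/
  | get (a : ℕ) (i : NExp)
  | add (e f : NExp)
  /-- truncated subtraction -/
  | sub (e f : NExp)

/-- Expressions with values in `ℝ`. -/
inductive RExp where
  | lit (c : ℚ)
  /-- entry of an array of reals -/
  | get (a : ℕ) (i : NExp)
  | ofNat (e : NExp)
  | add (e f : RExp)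
  | sub (e f : RExp)
  | mul (e f : RExp)
  | div (e f : RExp)
  /-- the value of the function `V` -/
  | bound (e : RExp)

/-- Tests. -/
inductive Test where
  | natLt (e f : NExp)
  | realLt (e f : RExp)
  | realLe (e f : RExp)

/-- Programs. -/
inductive Cmd where
  | skip
  /-- write into entry `i` of the array `a` of naturals -/
  | setNat (a : ℕ) (i : NExp) (e : NExp)
  /-- write into entry `i` of the array `a` of reals -/
  | setReal (a : ℕ) (i : NExp) (e : RExp)
  | seq (p q : Cmd)
  | ite (b : Test) (p q : Cmd)
  | loop (b : Test) (p : Cmd)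
  /-- sample a hash function and form its hash table on the points whose labels are the first `m`
  entries of the array `a` of naturals; the tables are numbered `0, 1, 2, …` -/
  | build (a : ℕ) (m : NExp)
  /-- evaluate the estimator of the table with number `t` at the point with label `q`; the label
  `I` is written into entry `0` of the array `a` of naturals (the number `n` of points stands for
  an empty cell), and the value `Z` into entry `0` of the array `b` of reals -/
  | query (t q : NExp) (a b : ℕ)

/-- What a program runs on: a hash family, a kernel, the function `V`, the complexity `T` of the
estimator and the `n` points of the dataset. -/
structure Env (E : Type w) (n : ℕ) where
  fam : HashFamily.{u, v, w} E
  ker : E → E → ℝ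
  bound : ℝ → ℝ
  cost : ℕ
  pt : Fin n → E

/-- Configurations of the machine. -/
structure State {E : Type w} {n : ℕ} (M : Env.{u, v, w} E n) where
  natMem : ℕ → ℕ → ℕ
  realMem : ℕ → ℕ → ℝ
  /-- the hash tables formed so far: hash function and labels of the points -/
  tables : List (M.fam.Fn × List (Fin n))
  /-- how many entries of the random tape have been used -/
  draws : ℕ
  /-- time elapsed -/
  time : ℕ
  /-- memory cells in use (array, index) -/
  natCells : Finset (ℕ × ℕ)
  realCells : Finset (ℕ × ℕ)

namespace NExp

variable {E : Type w} {n : ℕ} {M : Env.{u, v, w} E n}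

def eval (s : State M) : NExp → ℕ
  | lit c => c
  | get a i => s.natMem a (i.eval s)
  | add e f => e.eval s + f.eval s
  | sub e f => e.eval s - f.eval s

/-- The time needed to evaluate an expression. -/
def size : NExp → ℕ
  | lit _ => 1
  | get _ i => i.size + 1
  | add e f => e.size + f.size + 1
  | sub e f => e.size + f.size + 1

end NExp

namespace RExp

variable {E : Type w} {n : ℕ} {M : Env.{u, v, w} E n}

noncomputable def eval (s : State M) : RExp → ℝ
  | lit c => c
  | get a i => s.realMem a (i.eval s)
  | ofNat e => (e.eval s : ℝ)
  | add e f => e.eval s + f.eval s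
  | sub e f => e.eval s - f.eval s
  | mul e f => e.eval s * f.eval s
  | div e f => e.eval s / f.eval s
  | bound e => M.bound (e.eval s)

/-- The time needed to evaluate an expression. -/
def size : RExp → ℕ
  | lit _ => 1
  | get _ i => i.size + 1
  | ofNat e => e.size + 1
  | add e f => e.size + f.size + 1
  | sub e f => e.size + f.size + 1
  | mul e f => e.size + f.size + 1
  | div e f => e.size + f.size + 1
  | bound e => e.size + 1

end RExp

namespace Test

variable {E : Type w} {n : ℕ} {M : Env.{u, v, w} E n}

def Holds (s : State M) : Test → Prop
  | natLt e f => e.eval s < f.eval s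
  | realLt e f => e.eval s < f.eval s
  | realLe e f => e.eval s ≤ f.eval s

/-- The time needed for a test. -/
def size : Test → ℕ
  | natLt e f => e.size + f.size + 1
  | realLt e f => e.size + f.size + 1
  | realLe e f => e.size + f.size + 1

end Test

namespace State

variable {E : Type w} {n : ℕ} {M : Env.{u, v, w} E n}

/-- Let `c` units of time elapse. -/
def tick (s : State M) (c : ℕ) : State M := { s with time := s.time + c }

def writeNat (s : State M) (a i val : ℕ) : State M :=
  { s with
    natMem := Function.update s.natMem a (Function.update (s.natMem a) i val)
    natCells := insert (a, i) s.natCells }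

noncomputable def writeReal (s : State M) (a i : ℕ) (val : ℝ) : State M :=
  { s with
    realMem := Function.update s.realMem a (Function.update (s.realMem a) i val)
    realCells := insert (a, i) s.realCells }

/-- Append the hash table of `h` on the points with labels `S`; one entry of the tape is used. -/
def addTable (s : State M) (h : M.fam.Fn) (S : List (Fin n)) : State M :=
  { s with tables := s.tables ++ [(h, S)], draws := s.draws + 1 }

/-- Store the outcome of an evaluation of the estimator; one entry of the tape is used. -/
noncomputable def answer (s : State M) (a b : ℕ) (I : Option (Fin n)) (Z : ℝ) : State M :=
  { (s.writeNat a 0 (I.elim n Fin.val)).writeReal b 0 Z with draws := s.draws + 1 }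

/-- The space in use: memory cells, and `T · m` for every hash table on `m` points. Nothing is
ever freed, so that the space at the end is the peak. -/
def space (s : State M) : ℕ :=
  s.natCells.card + s.realCells.card + (s.tables.map fun t => M.cost * t.2.length).sum

end State

/-- `Exec M ω p s s'`: with random tape `ω`, the program `p` started in configuration `s` halts in
configuration `s'`. -/
inductive Exec {E : Type w} {n : ℕ} (M : Env.{u, v, w} E n) (ω : ℕ → M.fam.Fn × unitInterval) :
    Cmd → State M → State M → Prop where
  | skip (s : State M) : Exec M ω .skip s (s.tick 1)
  | setNat (s : State M) (a : ℕ) (i e : NExp) :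
      Exec M ω (.setNat a i e) s
        ((s.writeNat a (i.eval s) (e.eval s)).tick (i.size + e.size + 1))
  | setReal (s : State M) (a : ℕ) (i : NExp) (e : RExp) :
      Exec M ω (.setReal a i e) s
        ((s.writeReal a (i.eval s) (e.eval s)).tick (i.size + e.size + 1))
  | seq {p q : Cmd} {s s₁ s₂ : State M} (hp : Exec M ω p s s₁) (hq : Exec M ω q s₁ s₂) :
      Exec M ω (.seq p q) s s₂
  | iteTrue {b : Test} {p q : Cmd} {s s₁ : State M} (hb : b.Holds s)
      (hp : Exec M ω p (s.tick b.size) s₁) : Exec M ω (.ite b p q) s s₁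
  | iteFalse {b : Test} {p q : Cmd} {s s₁ : State M} (hb : ¬ b.Holds s)
      (hq : Exec M ω q (s.tick b.size) s₁) : Exec M ω (.ite b p q) s s₁
  | loopTrue {b : Test} {p : Cmd} {s s₁ s₂ : State M} (hb : b.Holds s)
      (hp : Exec M ω p (s.tick b.size) s₁) (hl : Exec M ω (.loop b p) s₁ s₂) :
      Exec M ω (.loop b p) s s₂
  | loopFalse {b : Test} {p : Cmd} {s : State M} (hb : ¬ b.Holds s) :
      Exec M ω (.loop b p) s (s.tick b.size)
  | build (s : State M) (a : ℕ) (m : NExp) (S : List (Fin n))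
      (hS : S.map Fin.val = (List.range (m.eval s)).map (s.natMem a)) :
      Exec M ω (.build a m) s
        ((s.addTable (ω s.draws).1 S).tick (m.size + 1 + M.cost * S.length))
  | query (s : State M) (t q : NExp) (a b : ℕ) (h : M.fam.Fn) (S : List (Fin n)) (i : Fin n)
      (ht : s.tables[t.eval s]? = some (h, S)) (hi : (i : ℕ) = q.eval s) :
      Exec M ω (.query t q a b) s
        ((s.answer a b (M.fam.draw M.pt S h (ω s.draws).2 (M.pt i))
          (M.fam.estimate M.ker M.pt S h (ω s.draws).2 (M.pt i))).tick
            (t.size + q.size + 1 + M.cost))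

/-- The machine is deterministic once the random tape is given. -/
theorem Exec.unique {E : Type w} {n : ℕ} {M : Env.{u, v, w} E n}
    {ω : ℕ → M.fam.Fn × unitInterval} {p : Cmd} {s s₁ s₂ : State M}
    (h₁ : Exec M ω p s s₁) (h₂ : Exec M ω p s s₂) : s₁ = s₂ := by
  induction h₁ generalizing s₂ with
  | skip s => cases h₂; rfl
  | setNat => cases h₂; rfl
  | setReal => cases h₂; rfl
  | seq _ _ ih₁ ih₂ =>
    cases h₂ with
    | seq hp hq => obtain rfl := ih₁ hp; exact ih₂ hq
  | iteTrue hb _ ih =>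
    cases h₂ with
    | iteTrue _ hp => exact ih hp
    | iteFalse hb' _ => exact absurd hb hb'
  | iteFalse hb _ ih =>
    cases h₂ with
    | iteTrue hb' _ => exact absurd hb' hb
    | iteFalse _ hp => exact ih hp
  | loopTrue hb _ _ ih₁ ih₂ =>
    cases h₂ with
    | loopTrue _ hp hl => obtain rfl := ih₁ hp; exact ih₂ hl
    | loopFalse hb' => exact absurd hb hb'
  | loopFalse hb =>
    cases h₂ with
    | loopTrue hb' _ _ => exact absurd hb' hb
    | loopFalse _ => rfl
  | build s a m S hS =>
    cases h₂ with
    | build _ _ _ S' hS' =>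
      obtain rfl : S = S' := Fin.val_injective.list_map (hS.trans hS'.symm)
      rfl
  | query s t q a b h S i ht hi =>
    cases h₂ with
    | query _ _ _ _ _ h' S' i' ht' hi' =>
      obtain rfl : i = i' := Fin.ext (hi.trans hi'.symm)
      obtain ⟨rfl, rfl⟩ := Prod.mk.inj (Option.some.inj (ht.symm.trans ht'))
      rfl

/-- The initial configuration on input `n`, `z`, `ε`, `τ`: the number `n` is entry `0` of array `0`
of naturals, the vector `z` is array `0` of reals, and `ε`, `τ` are the entries `0`, `1` of array
`1` of reals. All other cells hold `0`. -/
noncomputable def initState {E : Type w} {n : ℕ} (M : Env.{u, v, w} E n) (z : Fin n → ℝ)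
    (ε τ : ℝ) : State M where
  natMem a i := if a = 0 ∧ i = 0 then n else 0
  realMem a i :=
    if a = 0 then (if h : i < n then z ⟨i, h⟩ else 0)
    else if a = 1 ∧ i = 0 then ε
    else if a = 1 ∧ i = 1 then τ
    else 0
  tables := []
  draws := 0
  time := 0
  natCells := {(0, 0)}
  realCells := (Finset.range n).image (fun i => (0, i)) ∪ {(1, 0), (1, 1)}

/-- The output vector, read from array `2` of reals. -/
def output {E : Type w} {n : ℕ} {M : Env.{u, v, w} E n} (s : State M) : Fin n → ℝ :=
  fun i => s.realMem 2 i

/-- The `ℓ_p` norm of a vector. -/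
noncomputable def lpNorm {n : ℕ} (p : ℝ) (y : Fin n → ℝ) : ℝ :=
  (∑ i, |y i| ^ p) ^ (1 / p)

end HBE

/-! The estimator handles uniform averages, so the weights are cut into binary digits: up to a
residual, `z` is the sum over `b < L` of `2^(-b)` times the indicator of a set `S_b` of points
(`level`, `sum_level`). With `m` minimal such that `n 2^(-m) ≤ ετ` and `L = m + 1`, dropping the
residual lowers each entry of `Kz` by at most `ετ` (`truncated_le`, `le_truncated_add`).

One repetition draws `N` tables on every `S_b`, queries each at all points, and adds the answers
with factor `2^(-b) |S_b| / N`. This is unbiased for the truncated product `y'`. The core is the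
variance bound `V(t)/N · (y' + t)^2` with `t = ετ` (`variance_repSum_le`). The growth conditions on
`V` give `q^2 V(q) ≤ (q^2 + t^2) V(t)` at any density `q`, and the total weight `∑ 2^(-b) |S_b| ≤ 1`
keeps the `t`-terms from accumulating over the digits. With `N` about `16 (1 + V(t)) / ε^2`,
Chebyshev's inequality bounds by `1/16` the probability of an error of `ε (y' + t)` or more
(`measure_repSum_le`).

For a fixed point the `2L` repetitions read disjoint parts of the tape and are independent. At least
half of them fail with probability at most `4^(-L)` (`measure_half_le`); otherwise a median-like
order statistic is accurate (`IsSelected.abs_sub_le`). Different points share tables, so the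
repetitions are combined over points by a union bound only (`measure_bad_le`); it costs at most
`1/n` because `n 2^(-m) ≤ 1`.

On the machine side, `Exec.loop_of_invariant` with the frame property `Exec.frame` identifies
exactly which tape entries enter the output (`program_spec`). Space is charged to time
(`Exec.space_le`). -/

namespace HBE

open MeasureTheory ProbabilityTheory

universe u v w

/-! ### Effect of the machine operations on memory, tape and clock -/

section Machine

variable {E : Type w} {n : ℕ} {M : Env.{u, v, w} E n} {ω : ℕ → M.fam.Fn × unitInterval}

namespace State

@[simp] theorem natMem_tick (s : State M) (c : ℕ) : (s.tick c).natMem = s.natMem := rfl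
@[simp] theorem realMem_tick (s : State M) (c : ℕ) : (s.tick c).realMem = s.realMem := rfl
@[simp] theorem tables_tick (s : State M) (c : ℕ) : (s.tick c).tables = s.tables := rfl
@[simp] theorem draws_tick (s : State M) (c : ℕ) : (s.tick c).draws = s.draws := rfl
@[simp] theorem time_tick (s : State M) (c : ℕ) : (s.tick c).time = s.time + c := rfl

@[simp] theorem natMem_writeNat (s : State M) (a i x a' i' : ℕ) :
    (s.writeNat a i x).natMem a' i' = if a' = a ∧ i' = i then x else s.natMem a' i' := by
  by_cases h : a' = a
  · subst h; by_cases h' : i' = i <;> simp [writeNat, h']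
  · simp [writeNat, h]
@[simp] theorem realMem_writeNat (s : State M) (a i x : ℕ) :
    (s.writeNat a i x).realMem = s.realMem := rfl
@[simp] theorem tables_writeNat (s : State M) (a i x : ℕ) :
    (s.writeNat a i x).tables = s.tables := rfl
@[simp] theorem draws_writeNat (s : State M) (a i x : ℕ) :
    (s.writeNat a i x).draws = s.draws := rfl
@[simp] theorem time_writeNat (s : State M) (a i x : ℕ) :
    (s.writeNat a i x).time = s.time := rfl

@[simp] theorem realMem_writeReal (s : State M) (a i : ℕ) (x : ℝ) (a' i' : ℕ) :
    (s.writeReal a i x).realMem a' i' = if a' = a ∧ i' = i then x else s.realMem a' i' := by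
  by_cases h : a' = a
  · subst h; by_cases h' : i' = i <;> simp [writeReal, h']
  · simp [writeReal, h]
@[simp] theorem natMem_writeReal (s : State M) (a i : ℕ) (x : ℝ) :
    (s.writeReal a i x).natMem = s.natMem := rfl
@[simp] theorem tables_writeReal (s : State M) (a i : ℕ) (x : ℝ) :
    (s.writeReal a i x).tables = s.tables := rfl
@[simp] theorem draws_writeReal (s : State M) (a i : ℕ) (x : ℝ) :
    (s.writeReal a i x).draws = s.draws := rfl
@[simp] theorem time_writeReal (s : State M) (a i : ℕ) (x : ℝ) :
    (s.writeReal a i x).time = s.time := rfl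

@[simp] theorem natMem_addTable (s : State M) (h : M.fam.Fn) (S : List (Fin n)) :
    (s.addTable h S).natMem = s.natMem := rfl
@[simp] theorem realMem_addTable (s : State M) (h : M.fam.Fn) (S : List (Fin n)) :
    (s.addTable h S).realMem = s.realMem := rfl
@[simp] theorem tables_addTable (s : State M) (h : M.fam.Fn) (S : List (Fin n)) :
    (s.addTable h S).tables = s.tables ++ [(h, S)] := rfl
@[simp] theorem draws_addTable (s : State M) (h : M.fam.Fn) (S : List (Fin n)) :
    (s.addTable h S).draws = s.draws + 1 := rfl
@[simp] theorem time_addTable (s : State M) (h : M.fam.Fn) (S : List (Fin n)) :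
    (s.addTable h S).time = s.time := rfl

@[simp] theorem natMem_answer (s : State M) (a b : ℕ) (I : Option (Fin n)) (Z : ℝ) (a' i' : ℕ) :
    (s.answer a b I Z).natMem a' i' =
      if a' = a ∧ i' = 0 then I.elim n Fin.val else s.natMem a' i' :=
  natMem_writeNat s a 0 _ a' i'
@[simp] theorem realMem_answer (s : State M) (a b : ℕ) (I : Option (Fin n)) (Z : ℝ) (a' i' : ℕ) :
    (s.answer a b I Z).realMem a' i' = if a' = b ∧ i' = 0 then Z else s.realMem a' i' :=
  realMem_writeReal (s.writeNat a 0 _) b 0 Z a' i'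
@[simp] theorem tables_answer (s : State M) (a b : ℕ) (I : Option (Fin n)) (Z : ℝ) :
    (s.answer a b I Z).tables = s.tables := rfl
@[simp] theorem draws_answer (s : State M) (a b : ℕ) (I : Option (Fin n)) (Z : ℝ) :
    (s.answer a b I Z).draws = s.draws + 1 := rfl
@[simp] theorem time_answer (s : State M) (a b : ℕ) (I : Option (Fin n)) (Z : ℝ) :
    (s.answer a b I Z).time = s.time := rfl

end State

/-! ### Frames -/

namespace Cmd

/-- The arrays of naturals that a program may write. -/
def natWrites : Cmd → List ℕ
  | skip => []
  | setNat a _ _ => [a]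
  | setReal _ _ _ => []
  | seq p q => p.natWrites ++ q.natWrites
  | ite _ p q => p.natWrites ++ q.natWrites
  | loop _ p => p.natWrites
  | build _ _ => []
  | query _ _ a _ => [a]

/-- The arrays of reals that a program may write. -/
def realWrites : Cmd → List ℕ
  | skip => []
  | setNat _ _ _ => []
  | setReal a _ _ => [a]
  | seq p q => p.realWrites ++ q.realWrites
  | ite _ p q => p.realWrites ++ q.realWrites
  | loop _ p => p.realWrites
  | build _ _ => []
  | query _ _ _ b => [b]

/-- Whether a program may form hash tables. -/
def builds : Cmd → Bool
  | seq p q => p.builds || q.builds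
  | ite _ p q => p.builds || q.builds
  | loop _ p => p.builds
  | build _ _ => true
  | _ => false

/-- Whether a program may read the random tape. -/
def randomized : Cmd → Bool
  | seq p q => p.randomized || q.randomized
  | ite _ p q => p.randomized || q.randomized
  | loop _ p => p.randomized
  | build _ _ => true
  | query _ _ _ _ => true
  | _ => false

end Cmd

/-- The two configurations agree outside the part that the program `p` may modify. -/
structure Frame (p : Cmd) (s s' : State M) : Prop where
  nat : ∀ a, a ∉ p.natWrites → ∀ i, s'.natMem a i = s.natMem a i
  real : ∀ a, a ∉ p.realWrites → ∀ i, s'.realMem a i = s.realMem a i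
  tables : p.builds = false → s'.tables = s.tables
  draws : p.randomized = false → s'.draws = s.draws

namespace Frame

variable {p q : Cmd} {s s₁ s₂ : State M}

theorem refl (p : Cmd) (s : State M) : Frame p s s :=
  ⟨fun _ _ _ => rfl, fun _ _ _ => rfl, fun _ => rfl, fun _ => rfl⟩

theorem trans (h : Frame p s s₁) (h' : Frame p s₁ s₂) : Frame p s s₂ :=
  ⟨fun a ha i => (h'.nat a ha i).trans (h.nat a ha i),
    fun a ha i => (h'.real a ha i).trans (h.real a ha i),
    fun hb => (h'.tables hb).trans (h.tables hb), fun hb => (h'.draws hb).trans (h.draws hb)⟩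

theorem mono (h : Frame p s s₁) (h₁ : p.natWrites ⊆ q.natWrites)
    (h₂ : p.realWrites ⊆ q.realWrites) (h₃ : q.builds = false → p.builds = false)
    (h₄ : q.randomized = false → p.randomized = false) : Frame q s s₁ :=
  ⟨fun a ha => h.nat a fun h' => ha (h₁ h'), fun a ha => h.real a fun h' => ha (h₂ h'),
    fun hb => h.tables (h₃ hb), fun hb => h.draws (h₄ hb)⟩

theorem of_tick {c : ℕ} (h : Frame p (s.tick c) s₁) : Frame p s s₁ := ⟨h.1, h.2, h.3, h.4⟩

theorem tick {c : ℕ} (h : Frame p s s₁) : Frame p s (s₁.tick c) := ⟨h.1, h.2, h.3, h.4⟩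

end Frame

/-- What a program may modify can be read off its syntax, so for a concrete program `decide` or
`rfl` settles that a register survives. Loop invariants then need to mention only what changes. -/
theorem Exec.frame {p : Cmd} {s s' : State M} (h : Exec M ω p s s') : Frame p s s' := by
  induction h with
  | skip s => exact (Frame.refl _ s).tick
  | setNat s a i e =>
    refine ⟨fun a' ha j => ?_, fun _ _ _ => rfl, fun _ => rfl, fun _ => rfl⟩
    have : a' ≠ a := by simpa [Cmd.natWrites] using ha
    simp [this]
  | setReal s a i e =>
    refine ⟨fun _ _ _ => rfl, fun a' ha j => ?_, fun _ => rfl, fun _ => rfl⟩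
    have : a' ≠ a := by simpa [Cmd.realWrites] using ha
    simp [this]
  | seq _ _ ih₁ ih₂ =>
    refine (ih₁.mono ?_ ?_ ?_ ?_).trans (ih₂.mono ?_ ?_ ?_ ?_) <;>
      simp +contextual [Cmd.natWrites, Cmd.realWrites, Cmd.builds, Cmd.randomized]
  | iteTrue _ _ ih =>
    refine ih.of_tick.mono ?_ ?_ ?_ ?_ <;>
      simp +contextual [Cmd.natWrites, Cmd.realWrites, Cmd.builds, Cmd.randomized]
  | iteFalse _ _ ih =>
    refine ih.of_tick.mono ?_ ?_ ?_ ?_ <;>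
      simp +contextual [Cmd.natWrites, Cmd.realWrites, Cmd.builds, Cmd.randomized]
  | loopTrue _ _ _ ih₁ ih₂ =>
    exact (ih₁.of_tick.mono (List.Subset.refl _) (List.Subset.refl _) id id :
      Frame (.loop _ _) _ _).trans ih₂
  | loopFalse _ => exact (Frame.refl _ _).tick
  | build s a m S hS =>
    exact ⟨fun _ _ _ => rfl, fun _ _ _ => rfl, fun h => by simp [Cmd.builds] at h,
      fun h => by simp [Cmd.randomized] at h⟩
  | query s t q a b h S i ht hi =>
    refine ⟨fun a' ha j => ?_, fun a' ha j => ?_, fun _ => rfl,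
      fun h => by simp [Cmd.randomized] at h⟩
    · have : a' ≠ a := by simpa [Cmd.natWrites] using ha
      simp [this]
    · have : a' ≠ b := by simpa [Cmd.realWrites] using ha
      simp [this]

/-! ### Loops -/

/-- The rule for a loop that makes `m` rounds, each of which takes time at most `c`. -/
theorem Exec.loop_of_invariant {b : Test} {p : Cmd} (I : ℕ → State M → Prop) (m c : ℕ)
    {s₀ : State M} (h0 : I 0 s₀)
    (hstep : ∀ k < m, ∀ s, I k s → Frame p s₀ s → b.Holds s ∧
      ∃ s', Exec M ω p (s.tick b.size) s' ∧ s'.time ≤ s.time + c ∧ I (k + 1) s')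
    (hend : ∀ s, I m s → Frame p s₀ s → ¬ b.Holds s)
    (htick : ∀ s c, I m s → I m (s.tick c)) :
    ∃ s', Exec M ω (.loop b p) s₀ s' ∧ s'.time ≤ s₀.time + (m * c + b.size) ∧ I m s' := by
  suffices H : ∀ r k, k + r = m → ∀ s, I k s → Frame p s₀ s →
      ∃ s', Exec M ω (.loop b p) s s' ∧ s'.time ≤ s.time + (r * c + b.size) ∧ I m s' from
    H m 0 (by omega) s₀ h0 (Frame.refl _ _)
  intro r
  induction r with
  | zero =>
    intro k hk s hs hf
    obtain rfl : k = m := by omega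
    -- The final, failing test still takes time, which is why the invariant must survive a tick.
    exact ⟨_, .loopFalse (hend s hs hf), by simp, htick _ _ hs⟩
  | succ r ih =>
    intro k hk s hs hf
    obtain ⟨hb, s₁, hp, ht, hI⟩ := hstep k (by omega) s hs hf
    obtain ⟨s₂, hl, ht₂, hI₂⟩ := ih (k + 1) (by omega) s₁ hI (hf.trans hp.frame.of_tick)
    refine ⟨s₂, .loopTrue hb hp hl, ?_, hI₂⟩
    rw [Nat.succ_mul]
    omega

/-! ### Space -/

/-- Every new memory cell is paid for by a unit of time, and a table on `m` points costs `T · m` in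
both currencies. Hence space needs no analysis of its own. -/
theorem Exec.space_le {p : Cmd} {s s' : State M} (h : Exec M ω p s s') :
    s'.space + s.time ≤ s.space + s'.time := by
  induction h with
  | skip s => simp [State.space, State.tick]
  | setNat s a i e =>
    have := Finset.card_insert_le (a, i.eval s) s.natCells
    simp only [State.space, State.tick, State.writeNat]
    omega
  | setReal s a i e =>
    have := Finset.card_insert_le (a, i.eval s) s.realCells
    simp only [State.space, State.tick, State.writeReal]
    omega
  | seq _ _ ih₁ ih₂ => omega
  | iteTrue _ _ ih =>
    simp only [State.space, State.tick] at *
    omega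
  | iteFalse _ _ ih =>
    simp only [State.space, State.tick] at *
    omega
  | loopTrue _ _ _ ih₁ ih₂ =>
    simp only [State.space, State.tick] at *
    omega
  | loopFalse _ => simp [State.space, State.tick]
  | build s a m S hS =>
    simp only [State.space, State.tick, State.addTable, List.map_append, List.sum_append,
      List.map_cons, List.map_nil, List.sum_cons, List.sum_nil]
    omega
  | query s t q a b h S i ht hi =>
    have := Finset.card_insert_le (a, 0) s.natCells
    have := Finset.card_insert_le (b, 0) s.realCells
    -- A query may open two new cells, so its cost has to be at least 2.
    have : 1 ≤ t.size := by cases t <;> simp [NExp.size]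
    simp only [State.space, State.tick, State.answer, State.writeNat, State.writeReal]
    omega

end Machine

/-! ### The program -/

namespace KMV

/-- The scalar stored in the array `a` of naturals. -/
abbrev nvar (a : ℕ) : NExp := .get a (.lit 0)

/-- The scalar stored in the array `a` of reals. -/
abbrev rvar (a : ℕ) : RExp := .get a (.lit 0)

/-- Use of the arrays of naturals: 0 is `n`, 1 is `L`, 3 is `N`, 4 the digit, 5 and 7 the size and
the labels of the current level, 6 and 12 point counters, 8 and 10 the repetition and the sample, 11
the number of tables, 13 the discarded label `I`, 14 to 16 serve for counting. Array 9 holds the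
offset of the current block of accumulators, advanced by `n` because naturals cannot be multiplied.
Arrays of reals: 0 the residual weights, 1 the pair `ε`, `τ`, 2 the output, 3 the current power of
`1/2`, 4 the last answer, 5 the accumulators (repetition `r`, point `i` at `r n + i`), 6 the scaling
factor. -/
abbrev setn (a : ℕ) (e : NExp) : Cmd := .setNat a (.lit 0) e

abbrev setr (a : ℕ) (e : RExp) : Cmd := .setReal a (.lit 0) e

abbrev incr (a : ℕ) : Cmd := setn a (.add (nvar a) (.lit 1))

infixr:60 " ;; " => Cmd.seq

/-- Query the newest table at point number `i` and add the result to an accumulator. -/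
def queryStep : Cmd :=
  .query (nvar 11) (nvar 12) 13 4 ;;
  .setReal 5 (.add (nvar 9) (nvar 12))
    (.add (.get 5 (.add (nvar 9) (nvar 12))) (.mul (rvar 6) (rvar 4))) ;;
  incr 12

def queryLoop : Cmd := .loop (.natLt (nvar 12) (nvar 0)) queryStep

/-- One sample: form a table and query it at all points. -/
def sampleStep : Cmd :=
  .build 7 (nvar 5) ;; setn 12 (.lit 0) ;; queryLoop ;; incr 11 ;; incr 10

def sampleLoop : Cmd := .loop (.natLt (nvar 10) (nvar 3)) sampleStep

/-- One repetition: add up all samples. -/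
def repStep : Cmd :=
  setn 10 (.lit 0) ;; sampleLoop ;; setn 9 (.add (nvar 9) (nvar 0)) ;; incr 8

def repLoop : Cmd := .loop (.natLt (nvar 8) (.add (nvar 1) (nvar 1))) repStep

/-- Extract the current binary digit of one weight. -/
def digitStep : Cmd :=
  .ite (.realLe (rvar 3) (.get 0 (nvar 6)))
    (.setNat 7 (nvar 5) (nvar 6) ;; incr 5 ;;
      .setReal 0 (nvar 6) (.sub (.get 0 (nvar 6)) (rvar 3)))
    .skip ;;
  incr 6

def digitLoop : Cmd := .loop (.natLt (nvar 6) (nvar 0)) digitStep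

/-- All the work for one binary digit of the weights. -/
def levelStep : Cmd :=
  setn 5 (.lit 0) ;; setn 6 (.lit 0) ;; digitLoop ;;
  setr 6 (.div (.mul (rvar 3) (.ofNat (nvar 5))) (.ofNat (nvar 3))) ;;
  setn 8 (.lit 0) ;; setn 9 (.lit 0) ;; repLoop ;;
  setr 3 (.div (rvar 3) (.lit 2)) ;; incr 4

def levelLoop : Cmd := .loop (.natLt (nvar 4) (nvar 1)) levelStep

/-- Count the repetitions with at least the value of the current one. -/
def countStep : Cmd :=
  .ite (.realLe (.get 5 (nvar 9)) (.get 5 (nvar 16))) (incr 14) .skip ;;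
  setn 16 (.add (nvar 16) (nvar 0)) ;; incr 15

def countLoop : Cmd := .loop (.natLt (nvar 15) (.add (nvar 1) (nvar 1))) countStep

def selectStep : Cmd :=
  setn 14 (.lit 0) ;; setn 15 (.lit 0) ;; setn 16 (nvar 12) ;; countLoop ;;
  .ite (.natLt (nvar 14) (nvar 1)) .skip
    (.ite (.realLt (.get 2 (nvar 12)) (.get 5 (nvar 9)))
      (.setReal 2 (nvar 12) (.get 5 (nvar 9))) .skip) ;;
  setn 9 (.add (nvar 9) (nvar 0)) ;; incr 8

def selectLoop : Cmd := .loop (.natLt (nvar 8) (.add (nvar 1) (nvar 1))) selectStep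

/-- Compute one entry of the output. -/
def outStep : Cmd :=
  setn 8 (.lit 0) ;; setn 9 (nvar 12) ;; selectLoop ;; incr 12

def outLoop : Cmd := .loop (.natLt (nvar 12) (nvar 0)) outStep

def depthTest : Test :=
  .realLt (.mul (.get 1 (.lit 0)) (.get 1 (.lit 1))) (.mul (.ofNat (nvar 0)) (rvar 3))

def depthStep : Cmd := setr 3 (.div (rvar 3) (.lit 2)) ;; incr 1

/-- Compute the number of binary digits to be used. -/
def depthLoop : Cmd := .loop depthTest depthStep

def sizeTest : Test :=
  .realLt (.ofNat (nvar 3))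
    (.div (.mul (.lit 16)
      (.add (.lit 1) (.bound (.mul (.get 1 (.lit 0)) (.get 1 (.lit 1))))))
      (.mul (.get 1 (.lit 0)) (.get 1 (.lit 0))))

/-- Compute the number of samples per repetition. -/
def sizeLoop : Cmd := .loop sizeTest (incr 3)

/-- Approximate multiplication of a kernel matrix with a vector. -/
def program : Cmd :=
  setn 1 (.lit 1) ;; setr 3 (.lit 1) ;; depthLoop ;; sizeLoop ;; setr 3 (.lit 1) ;;
  levelLoop ;; setn 12 (.lit 0) ;; outLoop

/-! ### Correctness and running time of the sampling loops -/

section Specs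

variable {E : Type w} {n : ℕ} {M : Env.{u, v, w} E n} {ω : ℕ → M.fam.Fn × unitInterval}

/-- The answer of the table with hash function `(ω g).1`. -/
noncomputable abbrev ans (M : Env.{u, v, w} E n) (ω : ℕ → M.fam.Fn × unitInterval)
    (S : List (Fin n)) (g q : ℕ) (i : Fin n) : ℝ :=
  M.fam.estimate M.ker M.pt S (ω g).1 (ω q).2 (M.pt i)

/-- The table is shared by all points, but each query consumes its own tape entry. The last clause
protects the accumulators of the other repetitions. -/
theorem queryLoop_spec (s : State M) (S : List (Fin n)) (h : M.fam.Fn) (hn : s.natMem 0 0 = n)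
    (hi : s.natMem 12 0 = 0) (ht : s.tables[s.natMem 11 0]? = some (h, S)) :
    ∃ s', Exec M ω queryLoop s s' ∧ s'.time ≤ s.time + (n * (M.cost + 40) + 5) ∧
      s'.draws = s.draws + n ∧
      (∀ i : Fin n, s'.realMem 5 (s.natMem 9 0 + i) = s.realMem 5 (s.natMem 9 0 + i) +
        s.realMem 6 0 * M.fam.estimate M.ker M.pt S h (ω (s.draws + i)).2 (M.pt i)) ∧
      (∀ j, j < s.natMem 9 0 ∨ s.natMem 9 0 + n ≤ j → s'.realMem 5 j = s.realMem 5 j) := by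
  refine (Exec.loop_of_invariant (ω := ω) (s₀ := s)
    (b := .natLt (nvar 12) (nvar 0)) (p := queryStep)
    (fun k s' => s'.natMem 12 0 = k ∧ s'.draws = s.draws + k ∧
      (∀ i : Fin n, (i : ℕ) < k → s'.realMem 5 (s.natMem 9 0 + i) =
        s.realMem 5 (s.natMem 9 0 + i) +
        s.realMem 6 0 * M.fam.estimate M.ker M.pt S h (ω (s.draws + i)).2 (M.pt i)) ∧
      (∀ j, j < s.natMem 9 0 ∨ s.natMem 9 0 + k ≤ j → s'.realMem 5 j = s.realMem 5 j))
    n (M.cost + 40) ⟨hi, rfl, by simp, by simp⟩ ?_ ?_ (fun s c h => h)).imp ?_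
  · rintro k hk s₁ ⟨h12, hd, hA, hB⟩ hf
    have e0 : s₁.natMem 0 0 = n := (hf.nat 0 (by decide) 0).trans hn
    have e9 := hf.nat 9 (by decide) 0
    have e11 := hf.nat 11 (by decide) 0
    have e6 := hf.real 6 (by decide) 0
    have et := hf.tables rfl
    refine ⟨by simp [Test.Holds, NExp.eval, e0, h12, hk], _,
      .seq (.query _ _ _ _ _ h S ⟨k, hk⟩ (by simp [NExp.eval, e11, et, ht])
        (by simp [NExp.eval, h12])) (.seq (.setReal _ _ _ _) (.setNat _ _ _ _)), ?_, ?_, ?_, ?_, ?_⟩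
    · simp [Test.size, NExp.size, RExp.size]
      omega
    · simp [NExp.eval, h12]
    · simp [hd]; omega
    · intro i hik
      rcases Nat.lt_succ_iff_lt_or_eq.1 hik with hik | rfl
      · simp [NExp.eval, h12, e9, hA i hik, hik.ne]
      · simp [NExp.eval, RExp.eval, h12, e9, e6, hd, hB]
    · intro j hj
      have : j ≠ s.natMem 9 0 + k := by omega
      simp [NExp.eval, RExp.eval, h12, e9, this]
      exact hB j (by omega)
  · rintro s₁ ⟨h12, -⟩ hf
    simp [Test.Holds, NExp.eval, h12, hf.nat 0 (by decide) 0, hn]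
  · rintro s' ⟨he, htime, -, hd, h₁, h₂⟩
    exact ⟨he, by simpa [Test.size, NExp.size] using htime, hd, fun i => h₁ i i.2, h₂⟩

/-- A sample uses exactly `n + 1` tape entries, one for the table and one per point, so the number
`g` of tables formed so far determines the tape position `g (n + 1)`. -/
theorem sampleLoop_spec (s : State M) (S : List (Fin n)) (N g : ℕ) (hn : s.natMem 0 0 = n)
    (hs : s.natMem 10 0 = 0) (hN : s.natMem 3 0 = N) (hg : s.natMem 11 0 = g)
    (hS : S.map Fin.val = (List.range (s.natMem 5 0)).map (s.natMem 7))
    (ht : s.tables.length = g) (hd : s.draws = g * (n + 1)) :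
    ∃ s', Exec M ω sampleLoop s s' ∧
      s'.time ≤ s.time + (N * (n * (M.cost + 40) + M.cost * S.length + 60) + 5) ∧
      s'.natMem 11 0 = g + N ∧ s'.tables.length = g + N ∧ s'.draws = (g + N) * (n + 1) ∧
      (∀ i : Fin n, s'.realMem 5 (s.natMem 9 0 + i) = s.realMem 5 (s.natMem 9 0 + i) +
        ∑ l ∈ Finset.range N, s.realMem 6 0 *
          ans M ω S ((g + l) * (n + 1)) ((g + l) * (n + 1) + 1 + i) i) ∧
      (∀ j, j < s.natMem 9 0 ∨ s.natMem 9 0 + n ≤ j → s'.realMem 5 j = s.realMem 5 j) := by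
  refine (Exec.loop_of_invariant (ω := ω) (s₀ := s)
    (b := .natLt (nvar 10) (nvar 3)) (p := sampleStep)
    (fun k s' => s'.natMem 10 0 = k ∧ s'.natMem 11 0 = g + k ∧ s'.tables.length = g + k ∧
      s'.draws = (g + k) * (n + 1) ∧
      (∀ i : Fin n, s'.realMem 5 (s.natMem 9 0 + i) =
        s.realMem 5 (s.natMem 9 0 + i) + ∑ l ∈ Finset.range k, s.realMem 6 0 *
          ans M ω S ((g + l) * (n + 1)) ((g + l) * (n + 1) + 1 + i) i) ∧
      (∀ j, j < s.natMem 9 0 ∨ s.natMem 9 0 + n ≤ j → s'.realMem 5 j = s.realMem 5 j))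
    N (n * (M.cost + 40) + M.cost * S.length + 60)
    ⟨hs, hg, ht, hd, by simp, fun _ _ => rfl⟩ ?_ ?_ (fun s c h => h)).imp ?_
  · rintro k hk s₁ ⟨h10, h11, hl, hd', hA, hB⟩ hf
    have e0 : s₁.natMem 0 0 = n := (hf.nat 0 (by decide) 0).trans hn
    have e3 : s₁.natMem 3 0 = N := (hf.nat 3 (by decide) 0).trans hN
    have e9 := hf.nat 9 (by decide) 0
    have e5 := hf.nat 5 (by decide) 0
    have e7 := hf.nat 7 (by decide)
    have e6 := hf.real 6 (by decide) 0
    refine ⟨by simp [Test.Holds, NExp.eval, e3, h10, hk], ?_⟩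
    generalize hc : Test.size _ = c
    have hc5 : c = 5 := by rw [← hc]; rfl
    let s₂ : State M := (((s₁.tick c).addTable (ω s₁.draws).1 S).tick (3 + M.cost * S.length))
    let s₃ : State M := (s₂.writeNat 12 0 0).tick 3
    obtain ⟨s₄, x₄, t₄, d₄, a₄, b₄⟩ := queryLoop_spec (ω := ω) s₃ S (ω s₁.draws).1
      (by simp [s₃, s₂, e0]) (by simp [s₃, s₂]) (by simp [s₃, s₂, h11, ← hl])
    have f₄ := x₄.frame
    refine ⟨_, .seq (.build _ _ _ S ?_) (.seq (.setNat _ _ _ _) (.seq x₄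
      (.seq (.setNat _ _ _ _) (.setNat _ _ _ _)))), ?_, ?_, ?_, ?_, ?_, ?_, ?_⟩
    · rw [hS]
      simp only [NExp.eval, State.natMem_tick, e5]
      exact List.map_congr_left fun i _ => (e7 i).symm
    · simp [s₃, s₂] at t₄
      simp [NExp.size]
      omega
    · simp [NExp.eval, f₄.nat 10 (by decide), s₃, s₂, h10]
    · simp [NExp.eval, f₄.nat 11 (by decide), s₃, s₂, h11]; omega
    · simp [f₄.tables rfl, s₃, s₂, hl]; omega
    · simp [d₄, s₃, s₂, hd']; ring
    · intro i
      have := a₄ i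
      simp [s₃, s₂, e9, e6, hd'] at this
      simp [this, hA, Finset.sum_range_succ, ans]
      ring
    · intro j hj
      have := b₄ j (by simpa [s₃, s₂, e9] using hj)
      simp [s₃, s₂] at this
      simp [this, hB j hj]
  · rintro s₁ ⟨h10, -⟩ hf
    simp [Test.Holds, NExp.eval, h10, hf.nat 3 (by decide) 0, hN]
  · rintro s' ⟨he, htime, -, h11, hl, hd', h₁, h₂⟩
    exact ⟨he, by simpa [Test.size, NExp.size] using htime, h11, hl, hd', h₁, h₂⟩

theorem repLoop_spec (s : State M) (S : List (Fin n)) (N L g : ℕ) (hn : s.natMem 0 0 = n)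
    (hr : s.natMem 8 0 = 0) (hbase : s.natMem 9 0 = 0) (hL : s.natMem 1 0 = L)
    (hN : s.natMem 3 0 = N) (hg : s.natMem 11 0 = g)
    (hS : S.map Fin.val = (List.range (s.natMem 5 0)).map (s.natMem 7))
    (ht : s.tables.length = g) (hd : s.draws = g * (n + 1)) :
    ∃ s', Exec M ω repLoop s s' ∧
      s'.time ≤ s.time +
        ((L + L) * (N * (n * (M.cost + 40) + M.cost * S.length + 60) + 40) + 8) ∧
      s'.natMem 11 0 = g + (L + L) * N ∧ s'.tables.length = g + (L + L) * N ∧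
      s'.draws = (g + (L + L) * N) * (n + 1) ∧
      (∀ r < L + L, ∀ i : Fin n, s'.realMem 5 (r * n + i) = s.realMem 5 (r * n + i) +
        ∑ l ∈ Finset.range N, s.realMem 6 0 *
          ans M ω S ((g + r * N + l) * (n + 1)) ((g + r * N + l) * (n + 1) + 1 + i) i) := by
  refine (Exec.loop_of_invariant (ω := ω) (s₀ := s)
    (b := .natLt (nvar 8) (.add (nvar 1) (nvar 1))) (p := repStep)
    (fun k s' => s'.natMem 8 0 = k ∧ s'.natMem 9 0 = k * n ∧ s'.natMem 11 0 = g + k * N ∧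
      s'.tables.length = g + k * N ∧ s'.draws = (g + k * N) * (n + 1) ∧
      (∀ r < k, ∀ i : Fin n, s'.realMem 5 (r * n + i) = s.realMem 5 (r * n + i) +
        ∑ l ∈ Finset.range N, s.realMem 6 0 *
          ans M ω S ((g + r * N + l) * (n + 1)) ((g + r * N + l) * (n + 1) + 1 + i) i) ∧
      (∀ j, k * n ≤ j → s'.realMem 5 j = s.realMem 5 j))
    (L + L) (N * (n * (M.cost + 40) + M.cost * S.length + 60) + 40)
    ⟨hr, by simp [hbase], by simp [hg], by simp [ht], by simp [hd], by simp, fun _ _ => rfl⟩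
    ?_ ?_ (fun s c h => h)).imp ?_
  · rintro k hk s₁ ⟨h8, h9, h11, hl, hd', hA, hB⟩ hf
    have e0 : s₁.natMem 0 0 = n := (hf.nat 0 (by decide) 0).trans hn
    have e1 : s₁.natMem 1 0 = L := (hf.nat 1 (by decide) 0).trans hL
    have e3 : s₁.natMem 3 0 = N := (hf.nat 3 (by decide) 0).trans hN
    have e5 := hf.nat 5 (by decide) 0
    have e7 := hf.nat 7 (by decide)
    have e6 := hf.real 6 (by decide) 0
    refine ⟨by simp [Test.Holds, NExp.eval, e1, h8, hk], ?_⟩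
    generalize hc : Test.size _ = c
    have hc5 : c = 8 := by rw [← hc]; rfl
    let s₂ : State M := ((s₁.tick c).writeNat 10 0 0).tick 3
    obtain ⟨s₃, x₃, t₃, a₃, l₃, d₃, b₃, c₃⟩ := sampleLoop_spec (ω := ω) s₂ S N (g + k * N)
      (by simp [s₂, e0]) (by simp [s₂]) (by simp [s₂, e3]) (by simp [s₂, h11])
      (by
        rw [hS]
        simp only [State.natMem_tick, State.natMem_writeNat, s₂, e5]
        exact List.map_congr_left fun i _ => by simp [e7]) (by simp [s₂, hl]) (by simp [s₂, hd'])
    have f₃ := x₃.frame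
    refine ⟨_, .seq (.setNat _ _ _ _) (.seq x₃
      (.seq (.setNat _ _ _ _) (.setNat _ _ _ _))), ?_, ?_, ?_, ?_, ?_, ?_, ?_, ?_⟩
    · simp [s₂] at t₃
      simp [NExp.size]
      omega
    · simp [NExp.eval, f₃.nat 8 (by decide), s₂, h8]
    · simp [NExp.eval, f₃.nat 9 (by decide), f₃.nat 0 (by decide), s₂, h9, e0]; ring
    · simp [a₃]; ring
    · simp [l₃]; ring
    · simp [d₃]; ring
    · intro r hrk i
      simp only [State.realMem_tick, State.realMem_writeNat]
      rcases Nat.lt_succ_iff_lt_or_eq.1 hrk with hrk | rfl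
      · rw [c₃]
        · simp [s₂, hA r hrk i]
        · left
          -- The block of an earlier repetition `r` ends at `(r + 1) n ≤ k n`, before the block
          -- being written.
          have := Nat.mul_le_mul_right n (Nat.succ_le_of_lt hrk)
          rw [Nat.succ_mul] at this
          simp [s₂, h9]
          omega
      · have := b₃ i
        simp [s₂, h9] at this
        rw [this, hB _ (by omega), e6]
    · intro j hj
      rw [Nat.succ_mul] at hj
      simp only [State.realMem_tick, State.realMem_writeNat]
      rw [c₃]
      · simp [s₂, hB j (by omega)]
      · right
        simpa [s₂, h9] using hj
  · rintro s₁ ⟨h8, -⟩ hf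
    simp [Test.Holds, NExp.eval, h8, hf.nat 1 (by decide) 0, hL]
  · rintro s' ⟨he, htime, -, -, h11, hl, hd', h₁, h₂⟩
    exact ⟨he, by simpa [Test.size, NExp.size] using htime, h11, hl, hd', h₁⟩

end Specs

/-! ### Binary digits -/

/-- What is left of the weights after subtracting the first `b` binary digits. -/
noncomputable def residual {n : ℕ} (z : Fin n → ℝ) : ℕ → Fin n → ℝ
  | 0 => z
  | b + 1 => fun j =>
      if (1 / 2) ^ b ≤ residual z b j then residual z b j - (1 / 2) ^ b else residual z b j

open Classical in
/-- The points whose weight has the binary digit number `b` equal to `1`. -/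
noncomputable def level {n : ℕ} (z : Fin n → ℝ) (b : ℕ) : List (Fin n) :=
  (List.finRange n).filter fun j => (1 / 2) ^ b ≤ residual z b j

theorem length_level_le {n : ℕ} (z : Fin n → ℝ) (b : ℕ) : (level z b).length ≤ n :=
  (List.length_filter_le _ _).trans (List.length_finRange).le

/-- Writing into the first free entry of an array appends to the list stored there. -/
theorem map_range_append {f g : ℕ → ℕ} {m m' x : ℕ} (hm : m' = m + 1)
    (hfg : ∀ i < m, g i = f i) (hx : g m = x) :
    (List.range m).map f ++ [x] = (List.range m').map g := by
  subst hm hx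
  rw [List.range_succ, List.map_append]
  congr 1
  exact List.map_congr_left fun i hi => (hfg i (List.mem_range.1 hi)).symm

/-! ### Correctness of the digit extraction and of the loop over digits -/

section Specs

variable {E : Type w} {n : ℕ} {M : Env.{u, v, w} E n} {ω : ℕ → M.fam.Fn × unitInterval}

open Classical in
-- Points are scanned in increasing order, so the array of labels agrees with the filtered list in
-- order as well, as the rule for `build` requires. The residual weights replace the old ones in
-- place.
theorem digitLoop_spec (s : State M) (x : ℝ) (ρ : Fin n → ℝ) (hn : s.natMem 0 0 = n)
    (h5 : s.natMem 5 0 = 0) (h6 : s.natMem 6 0 = 0) (hx : s.realMem 3 0 = x)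
    (hρ : ∀ i : Fin n, s.realMem 0 i = ρ i) :
    ∃ s', Exec M ω digitLoop s s' ∧ s'.time ≤ s.time + (n * 40 + 5) ∧
      s'.natMem 5 0 = ((List.finRange n).filter fun j => x ≤ ρ j).length ∧
      ((List.finRange n).filter fun j => x ≤ ρ j).map Fin.val =
        (List.range (s'.natMem 5 0)).map (s'.natMem 7) ∧
      ∀ i : Fin n, s'.realMem 0 i = if x ≤ ρ i then ρ i - x else ρ i := by
  refine (Exec.loop_of_invariant (ω := ω) (s₀ := s) (b := .natLt (nvar 6) (nvar 0))
    (p := digitStep)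
    (fun k s' => s'.natMem 6 0 = k ∧
      s'.natMem 5 0 = (((List.finRange n).take k).filter fun j => x ≤ ρ j).length ∧
      (((List.finRange n).take k).filter fun j => x ≤ ρ j).map Fin.val =
        (List.range (s'.natMem 5 0)).map (s'.natMem 7) ∧
      (∀ i : Fin n, (i : ℕ) < k → s'.realMem 0 i = if x ≤ ρ i then ρ i - x else ρ i) ∧
      (∀ i : Fin n, k ≤ i → s'.realMem 0 i = ρ i))
    n 40 ⟨h6, by simp [h5], by simp [h5], by simp, fun i _ => hρ i⟩ ?_ ?_
    (fun s c h => h)).imp ?_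
  · rintro k hk s₁ ⟨h6, h5, hl, hA, hB⟩ hf
    have e0 : s₁.natMem 0 0 = n := (hf.nat 0 (by decide) 0).trans hn
    have e3 : s₁.realMem 3 0 = x := (hf.real 3 (by decide) 0).trans hx
    have ek : s₁.realMem 0 k = ρ ⟨k, hk⟩ := hB ⟨k, hk⟩ le_rfl
    have htake : (List.finRange n).take (k + 1) = (List.finRange n).take k ++ [⟨k, hk⟩] := by
      rw [List.take_add_one, List.getElem?_eq_getElem (by simpa using hk)]
      simp
    refine ⟨by simp [Test.Holds, NExp.eval, e0, h6, hk], ?_⟩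
    by_cases hc : x ≤ ρ ⟨k, hk⟩
    · refine ⟨_, .seq (.iteTrue (by simpa [Test.Holds, NExp.eval, RExp.eval, e3, h6, ek] using hc)
        (.seq (.setNat _ _ _ _) (.seq (.setNat _ _ _ _) (.setReal _ _ _ _)))) (.setNat _ _ _ _),
        ?_, ?_, ?_, ?_, ?_, ?_⟩
      · simp [Test.size, NExp.size, RExp.size]
      · simp [NExp.eval, h6]
      · simp [NExp.eval, htake, hc, h5]
      · rw [htake, List.filter_append, List.map_append, hl]
        have e : [(⟨k, hk⟩ : Fin n)].filter (fun j => x ≤ ρ j) = [⟨k, hk⟩] := by simp [hc]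
        rw [e]
        refine map_range_append ?_ ?_ ?_
        · simp [NExp.eval]
        · intro i hi
          simp [NExp.eval, hi.ne]
        · simp [NExp.eval, h6]
      · intro i hik
        rcases Nat.lt_succ_iff_lt_or_eq.1 hik with hik | hik
        · simp [NExp.eval, h6, hik.ne, hA i hik]
        · obtain rfl : i = ⟨k, hk⟩ := Fin.ext hik
          simp [NExp.eval, RExp.eval, h6, hc, ek, e3]
      · intro i hik
        have : (i : ℕ) ≠ k := by omega
        simp [NExp.eval, h6, this, hB i (by omega)]
    · refine ⟨_, .seq (.iteFalse (by simpa [Test.Holds, NExp.eval, RExp.eval, e3, h6, ek] using hc)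
        (.skip _)) (.setNat _ _ _ _), ?_, ?_, ?_, ?_, ?_, ?_⟩
      · simp [Test.size, NExp.size, RExp.size]
      · simp [NExp.eval, h6]
      · simp [NExp.eval, htake, hc, h5]
      · rw [htake, List.filter_append, List.map_append, hl]
        simp [NExp.eval, hc]
      · intro i hik
        rcases Nat.lt_succ_iff_lt_or_eq.1 hik with hik | hik
        · simp [hA i hik]
        · obtain rfl : i = ⟨k, hk⟩ := Fin.ext hik
          simp [hc, ek]
      · intro i hik
        simp [hB i (by omega)]
  · rintro s₁ ⟨h6, -⟩ hf
    simp [Test.Holds, NExp.eval, h6, hf.nat 0 (by decide) 0, hn]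
  · rintro s' ⟨he, htime, -, h5, hl, hA, -⟩
    have hT : (List.finRange n).take n = List.finRange n := List.take_of_length_le (by simp)
    rw [hT] at h5 hl
    exact ⟨he, by simpa [Test.size, NExp.size] using htime, h5, hl, fun i => hA i i.2⟩

/-- The scaling factor of the samples for the binary digit `b`. -/
noncomputable def coef (z : Fin n → ℝ) (N b : ℕ) : ℝ := (1 / 2) ^ b * (level z b).length / N

/-- The contribution of the binary digit `b` to repetition number `r`. -/
noncomputable def levelSum (M : Env.{u, v, w} E n) (ω : ℕ → M.fam.Fn × unitInterval)
    (z : Fin n → ℝ) (L N r : ℕ) (i : Fin n) (b : ℕ) : ℝ :=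
  ∑ l ∈ Finset.range N, coef z N b * ans M ω (level z b)
    ((b * ((L + L) * N) + r * N + l) * (n + 1))
    ((b * ((L + L) * N) + r * N + l) * (n + 1) + 1 + i) i

theorem levelLoop_spec (s : State M) (z : Fin n → ℝ) (L N : ℕ) (hn : s.natMem 0 0 = n)
    (hL : s.natMem 1 0 = L) (hN : s.natMem 3 0 = N) (h4 : s.natMem 4 0 = 0)
    (h11 : s.natMem 11 0 = 0) (ht : s.tables = []) (hd : s.draws = 0) (h3 : s.realMem 3 0 = 1)
    (hz : ∀ i : Fin n, s.realMem 0 i = z i) (ha : ∀ j, s.realMem 5 j = 0) :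
    ∃ s', Exec M ω levelLoop s s' ∧
      s'.time ≤ s.time + (L * (n * 40 + (L + L) *
        (N * (n * (M.cost + 40) + M.cost * n + 60) + 40) + 100) + 5) ∧
      (∀ r < L + L, ∀ i : Fin n, s'.realMem 5 (r * n + i) =
        ∑ b ∈ Finset.range L, levelSum M ω z L N r i b) := by
  refine (Exec.loop_of_invariant (ω := ω) (s₀ := s) (b := .natLt (nvar 4) (nvar 1))
    (p := levelStep)
    (fun k s' => s'.natMem 4 0 = k ∧ s'.natMem 11 0 = k * ((L + L) * N) ∧
      s'.tables.length = k * ((L + L) * N) ∧ s'.draws = k * ((L + L) * N) * (n + 1) ∧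
      s'.realMem 3 0 = (1 / 2) ^ k ∧ (∀ i : Fin n, s'.realMem 0 i = residual z k i) ∧
      (∀ r < L + L, ∀ i : Fin n, s'.realMem 5 (r * n + i) =
        ∑ b ∈ Finset.range k, levelSum M ω z L N r i b))
    L (n * 40 + (L + L) * (N * (n * (M.cost + 40) + M.cost * n + 60) + 40) + 100)
    ⟨h4, by simp [h11], by simp [ht], by simp [hd], by simp [h3], fun i => hz i, by simp [ha]⟩
    ?_ ?_ (fun s c h => h)).imp ?_
  · rintro k hk s₁ ⟨h4, h11, hl, hd', h3, hz, hA⟩ hf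
    have e0 : s₁.natMem 0 0 = n := (hf.nat 0 (by decide) 0).trans hn
    have e1 : s₁.natMem 1 0 = L := (hf.nat 1 (by decide) 0).trans hL
    have eN : s₁.natMem 3 0 = N := (hf.nat 3 (by decide) 0).trans hN
    refine ⟨by simp [Test.Holds, NExp.eval, e1, h4, hk], ?_⟩
    generalize hc : Test.size _ = c
    have hc5 : c = 5 := by rw [← hc]; rfl
    let s₂ : State M := ((((s₁.tick c).writeNat 5 0 0).tick 3).writeNat 6 0 0).tick 3
    obtain ⟨s₃, x₃, t₃, m₃, l₃, z₃⟩ := digitLoop_spec (ω := ω) s₂ ((1 / 2) ^ k) (residual z k)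
      (by simp [s₂, e0]) (by simp [s₂]) (by simp [s₂]) (by simp [s₂, h3]) (by simp [s₂, hz])
    have f₃ := x₃.frame
    have l₃' : (level z k).map Fin.val = (List.range (s₃.natMem 5 0)).map (s₃.natMem 7) := l₃
    have m₃' : s₃.natMem 5 0 = (level z k).length := m₃
    let s₄ : State M := ((((((s₃.writeReal 6 0 (coef z N k)).tick 12).writeNat 8 0 0).tick
      3).writeNat 9 0 0).tick 3)
    obtain ⟨s₅, x₅, t₅, g₅, q₅, d₅, a₅⟩ := repLoop_spec (ω := ω) s₄ (level z k) N L
      (k * ((L + L) * N))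
      (by simp [s₄, f₃.nat 0 (by decide), s₂, e0]) (by simp [s₄]) (by simp [s₄])
      (by simp [s₄, f₃.nat 1 (by decide), s₂, e1]) (by simp [s₄, f₃.nat 3 (by decide), s₂, eN])
      (by simp [s₄, f₃.nat 11 (by decide), s₂, h11])
      (by
        rw [l₃']
        simp only [State.natMem_tick, State.natMem_writeNat, State.natMem_writeReal, s₄]
        exact List.map_congr_left fun i _ => by simp) (by simp [s₄, f₃.tables rfl, s₂, hl])
      (by simp [s₄, f₃.draws rfl, s₂, hd'])
    have f₅ := x₅.frame
    -- The estimator targets the mean over the level; the factor `|S_b|` turns it into a sum,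
    -- `2^(-b)` is the value of the digit, and `1/N` averages the samples.
    have hcoef : RExp.eval s₃ (.div (.mul (rvar 3) (.ofNat (nvar 5))) (.ofNat (nvar 3))) =
        coef z N k := by
      simp [RExp.eval, NExp.eval, m₃', f₃.real 3 (by decide), f₃.nat 3 (by decide), s₂, h3, eN,
        coef]
    have x₆ := Exec.setReal (ω := ω) s₃ 6 (.lit 0)
      (.div (.mul (rvar 3) (.ofNat (nvar 5))) (.ofNat (nvar 3)))
    rw [hcoef] at x₆
    refine ⟨_, .seq (.setNat _ _ _ _) (.seq (.setNat _ _ _ _) (.seq x₃ (.seq x₆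
      (.seq (.setNat _ _ _ _) (.seq (.setNat _ _ _ _) (.seq x₅
      (.seq (.setReal _ _ _ _) (.setNat _ _ _ _)))))))), ?_, ?_, ?_, ?_, ?_, ?_, ?_, ?_⟩
    · simp [s₂] at t₃
      simp [s₄] at t₅
      have : (L + L) * (N * (n * (M.cost + 40) + M.cost * (level z k).length + 60) + 40) ≤
          (L + L) * (N * (n * (M.cost + 40) + M.cost * n + 60) + 40) := by
        gcongr
        exact length_level_le z k
      simp [NExp.size, RExp.size]
      omega
    · simp [NExp.eval, f₅.nat 4 (by decide), s₄, f₃.nat 4 (by decide), s₂, h4]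
    · simp [g₅]; ring
    · simp [q₅]; ring
    · simp [d₅]; ring
    · simp [RExp.eval, NExp.eval, f₅.real 3 (by decide), s₄, f₃.real 3 (by decide), s₂, h3]
      ring
    · intro i
      simp [f₅.real 0 (by decide), s₄, z₃, residual]
    · intro r hr i
      have := a₅ r hr i
      simp [s₄, f₃.real 5 (by decide), s₂] at this
      simp [this, hA r hr i, Finset.sum_range_succ, levelSum]
  · rintro s₁ ⟨h4, -⟩ hf
    simp [Test.Holds, NExp.eval, h4, hf.nat 1 (by decide) 0, hL]
  · rintro s' ⟨he, htime, -, -, -, -, -, -, hA⟩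
    exact ⟨he, by simpa [Test.size, NExp.size] using htime, hA⟩

end Specs

/-! ### Selecting the output among the repetitions -/

open Classical in
/-- The number of entries among `a 0, …, a (m - 1)` with at least the value `x`. -/
noncomputable def countGE (a : ℕ → ℝ) (m : ℕ) (x : ℝ) : ℕ :=
  ((Finset.range m).filter fun r => x ≤ a r).card

theorem countGE_succ (a : ℕ → ℝ) (m : ℕ) (x : ℝ) [Decidable (x ≤ a m)] :
    countGE a (m + 1) x = countGE a m x + if x ≤ a m then 1 else 0 := by
  unfold countGE
  rw [Finset.range_add_one, Finset.filter_insert]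
  split_ifs <;> simp

/-- The number `x` is the largest among `0` and those of the first `m` entries of `a` that are
exceeded or attained by at least `L` of the first `R` entries. -/
structure IsSelected (a : ℕ → ℝ) (R L m : ℕ) (x : ℝ) : Prop where
  mem : x = 0 ∨ ∃ r < m, L ≤ countGE a R (a r) ∧ x = a r
  le : ∀ r < m, L ≤ countGE a R (a r) → a r ≤ x

section Specs

variable {E : Type w} {n : ℕ} {M : Env.{u, v, w} E n} {ω : ℕ → M.fam.Fn × unitInterval}

theorem countLoop_spec (s : State M) (L i : ℕ) (hn : s.natMem 0 0 = n) (hL : s.natMem 1 0 = L)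
    (h14 : s.natMem 14 0 = 0) (h15 : s.natMem 15 0 = 0) (h16 : s.natMem 16 0 = i) :
    ∃ s', Exec M ω countLoop s s' ∧ s'.time ≤ s.time + ((L + L) * 40 + 8) ∧
      s'.natMem 14 0 =
        countGE (fun r => s.realMem 5 (r * n + i)) (L + L) (s.realMem 5 (s.natMem 9 0)) := by
  refine (Exec.loop_of_invariant (ω := ω) (s₀ := s) (b := .natLt (nvar 15) (.add (nvar 1) (nvar 1)))
    (p := countStep)
    (fun k s' => s'.natMem 15 0 = k ∧ s'.natMem 16 0 = k * n + i ∧ s'.natMem 14 0 =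
      countGE (fun r => s.realMem 5 (r * n + i)) k (s.realMem 5 (s.natMem 9 0)))
    (L + L) 40 ⟨h15, by simp [h16], by simp [h14, countGE]⟩ ?_ ?_ (fun s c h => h)).imp ?_
  · rintro k hk s₁ ⟨h15, h16, h14⟩ hf
    have e0 : s₁.natMem 0 0 = n := (hf.nat 0 (by decide) 0).trans hn
    have e1 : s₁.natMem 1 0 = L := (hf.nat 1 (by decide) 0).trans hL
    have e9 := hf.nat 9 (by decide) 0
    have e5 := hf.real 5 (by decide)
    refine ⟨by simp [Test.Holds, NExp.eval, e1, h15, hk], ?_⟩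
    classical
    rw [countGE_succ]
    by_cases hc : s.realMem 5 (s.natMem 9 0) ≤ s.realMem 5 (k * n + i)
    · refine ⟨_, .seq (.iteTrue (by simpa [Test.Holds, NExp.eval, RExp.eval, e9, h16, e5] using hc)
        (.setNat _ _ _ _)) (.seq (.setNat _ _ _ _) (.setNat _ _ _ _)), ?_, ?_, ?_, ?_⟩
      · simp [Test.size, NExp.size, RExp.size]
      · simp [NExp.eval, h15]
      · simp [NExp.eval, h16, e0]; ring
      · simp [NExp.eval, h14, hc]
    · refine ⟨_, .seq (.iteFalse (by simpa [Test.Holds, NExp.eval, RExp.eval, e9, h16, e5] using hc)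
        (.skip _)) (.seq (.setNat _ _ _ _) (.setNat _ _ _ _)), ?_, ?_, ?_, ?_⟩
      · simp [Test.size, NExp.size, RExp.size]
      · simp [NExp.eval, h15]
      · simp [NExp.eval, h16, e0]; ring
      · simp [h14, hc]
  · rintro s₁ ⟨h15, -⟩ hf
    simp [Test.Holds, NExp.eval, h15, hf.nat 1 (by decide) 0, hL]
  · rintro s' ⟨he, htime, -, -, h⟩
    exact ⟨he, by simpa [Test.size, NExp.size] using htime, h⟩

/-- A running maximum starting from the initial `0` of the output cell, which explains the default
in `IsSelected`. Counting anew for each candidate is quadratic in `L`, which is harmless as `L` is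
logarithmic. -/
theorem selectLoop_spec (s : State M) (L i : ℕ) (hn : s.natMem 0 0 = n) (hL : s.natMem 1 0 = L)
    (h8 : s.natMem 8 0 = 0) (h9 : s.natMem 9 0 = i) (h12 : s.natMem 12 0 = i)
    (h2 : s.realMem 2 i = 0) :
    ∃ s', Exec M ω selectLoop s s' ∧
      s'.time ≤ s.time + ((L + L) * ((L + L) * 40 + 60) + 8) ∧
      IsSelected (fun r => s.realMem 5 (r * n + i)) (L + L) L (L + L) (s'.realMem 2 i) ∧
      ∀ j, j ≠ i → s'.realMem 2 j = s.realMem 2 j := by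
  refine (Exec.loop_of_invariant (ω := ω) (s₀ := s) (b := .natLt (nvar 8) (.add (nvar 1) (nvar 1)))
    (p := selectStep)
    (fun k s' => s'.natMem 8 0 = k ∧ s'.natMem 9 0 = k * n + i ∧
      IsSelected (fun r => s.realMem 5 (r * n + i)) (L + L) L k (s'.realMem 2 i) ∧
      ∀ j, j ≠ i → s'.realMem 2 j = s.realMem 2 j)
    (L + L) ((L + L) * 40 + 60) ⟨h8, by simp [h9], ⟨.inl h2, by simp⟩, fun _ _ => rfl⟩
    ?_ ?_ (fun s c h => h)).imp ?_
  · rintro k hk s₁ ⟨h8, h9, hA, hB⟩ hf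
    have e0 : s₁.natMem 0 0 = n := (hf.nat 0 (by decide) 0).trans hn
    have e1 : s₁.natMem 1 0 = L := (hf.nat 1 (by decide) 0).trans hL
    have e12 : s₁.natMem 12 0 = i := (hf.nat 12 (by decide) 0).trans h12
    have e5 := hf.real 5 (by decide)
    refine ⟨by simp [Test.Holds, NExp.eval, e1, h8, hk], ?_⟩
    generalize hc : Test.size _ = c
    have hc8 : c = 8 := by rw [← hc]; rfl
    let s₂ : State M := ((((((s₁.tick c).writeNat 14 0 0).tick 3).writeNat 15 0 0).tick 3).writeNat
      16 0 (s₁.natMem 12 0)).tick 4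
    obtain ⟨s₃, x₃, t₃, c₃⟩ := countLoop_spec (ω := ω) s₂ L i (by simp [s₂, e0]) (by simp [s₂, e1])
      (by simp [s₂]) (by simp [s₂]) (by simp [s₂, e12])
    have f₃ := x₃.frame
    set a : ℕ → ℝ := fun r => s.realMem 5 (r * n + i) with ha
    have c₃' : s₃.natMem 14 0 = countGE a (L + L) (a k) := by
      simpa [s₂, h9, e5, ha] using c₃
    have u1 : s₃.natMem 1 0 = L := by simp [f₃.nat 1 (by decide), s₂, e1]
    have u12 : s₃.natMem 12 0 = i := by simp [f₃.nat 12 (by decide), s₂, e12]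
    have u5 : s₃.realMem 5 (s₃.natMem 9 0) = a k := by
      simp [f₃.real 5 (by decide), f₃.nat 9 (by decide), s₂, h9, e5, ha]
    have u2 : ∀ j, s₃.realMem 2 j = s₁.realMem 2 j := fun j => by
      simp [f₃.real 2 (by decide), s₂]
    simp [s₂] at t₃
    by_cases hlt : s₃.natMem 14 0 < L
    · refine ⟨_, .seq (.setNat _ _ _ _) (.seq (.setNat _ _ _ _) (.seq (.setNat _ _ _ _) (.seq x₃
        (.seq (.iteTrue (by simpa [Test.Holds, NExp.eval, u1] using hlt) (.skip _))
        (.seq (.setNat _ _ _ _) (.setNat _ _ _ _)))))), ?_, ?_, ?_, ?_, ?_⟩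
      · simp [Test.size, NExp.size]
        omega
      · simp [NExp.eval, f₃.nat 8 (by decide), s₂, h8]
      · simp [NExp.eval, f₃.nat 9 (by decide), f₃.nat 0 (by decide), s₂, h9, e0]; ring
      · simp only [State.realMem_tick, State.realMem_writeNat, u2]
        refine ⟨hA.mem.imp_right fun ⟨r, hr, h⟩ => ⟨r, hr.trans (Nat.lt_succ_self k), h⟩,
          fun r hr hL => ?_⟩
        rcases Nat.lt_succ_iff_lt_or_eq.1 hr with hr | rfl
        · exact hA.le r hr hL
        · omega
      · intro j hj
        simp [u2, hB j hj]
    · by_cases hv : s₁.realMem 2 i < a k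
      · refine ⟨_, .seq (.setNat _ _ _ _) (.seq (.setNat _ _ _ _) (.seq (.setNat _ _ _ _) (.seq x₃
          (.seq (.iteFalse (by simpa [Test.Holds, NExp.eval, u1] using hlt) (.iteTrue
          (by simpa [Test.Holds, NExp.eval, RExp.eval, u12, u5, u2] using hv) (.setReal _ _ _ _)))
          (.seq (.setNat _ _ _ _) (.setNat _ _ _ _)))))), ?_, ?_, ?_, ?_, ?_⟩
        · simp [Test.size, NExp.size, RExp.size]
          omega
        · simp [NExp.eval, f₃.nat 8 (by decide), s₂, h8]
        · simp [NExp.eval, f₃.nat 9 (by decide), f₃.nat 0 (by decide), s₂, h9, e0]; ring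
        · simp [NExp.eval, RExp.eval, u12, u5]
          refine ⟨.inr ⟨k, Nat.lt_succ_self k, by omega, rfl⟩, fun r hr hL => ?_⟩
          rcases Nat.lt_succ_iff_lt_or_eq.1 hr with hr | rfl
          · exact (hA.le r hr hL).trans hv.le
          · exact le_rfl
        · intro j hj
          simp [NExp.eval, u12, hj, u2, hB j hj]
      · refine ⟨_, .seq (.setNat _ _ _ _) (.seq (.setNat _ _ _ _) (.seq (.setNat _ _ _ _) (.seq x₃
          (.seq (.iteFalse (by simpa [Test.Holds, NExp.eval, u1] using hlt) (.iteFalse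
          (by simpa [Test.Holds, NExp.eval, RExp.eval, u12, u5, u2] using hv) (.skip _)))
          (.seq (.setNat _ _ _ _) (.setNat _ _ _ _)))))), ?_, ?_, ?_, ?_, ?_⟩
        · simp [Test.size, NExp.size, RExp.size]
          omega
        · simp [NExp.eval, f₃.nat 8 (by decide), s₂, h8]
        · simp [NExp.eval, f₃.nat 9 (by decide), f₃.nat 0 (by decide), s₂, h9, e0]; ring
        · simp only [State.realMem_tick, State.realMem_writeNat, u2]
          refine ⟨hA.mem.imp_right fun ⟨r, hr, h⟩ => ⟨r, hr.trans (Nat.lt_succ_self k), h⟩,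
            fun r hr hL => ?_⟩
          rcases Nat.lt_succ_iff_lt_or_eq.1 hr with hr | rfl
          · exact hA.le r hr hL
          · exact not_lt.1 hv
        · intro j hj
          simp [u2, hB j hj]
  · rintro s₁ ⟨h8, -⟩ hf
    simp [Test.Holds, NExp.eval, h8, hf.nat 1 (by decide) 0, hL]
  · rintro s' ⟨he, htime, -, -, h, h'⟩
    exact ⟨he, by simpa [Test.size, NExp.size] using htime, h, h'⟩

theorem outLoop_spec (s : State M) (L : ℕ) (hn : s.natMem 0 0 = n) (hL : s.natMem 1 0 = L)
    (h12 : s.natMem 12 0 = 0) (h2 : ∀ i, s.realMem 2 i = 0) :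
    ∃ s', Exec M ω outLoop s s' ∧
      s'.time ≤ s.time + (n * ((L + L) * ((L + L) * 40 + 60) + 40) + 5) ∧
      ∀ i : Fin n,
        IsSelected (fun r => s.realMem 5 (r * n + i)) (L + L) L (L + L) (s'.realMem 2 i) := by
  refine (Exec.loop_of_invariant (ω := ω) (s₀ := s) (b := .natLt (nvar 12) (nvar 0))
    (p := outStep)
    (fun k s' => s'.natMem 12 0 = k ∧
      (∀ i : Fin n, (i : ℕ) < k →
        IsSelected (fun r => s.realMem 5 (r * n + i)) (L + L) L (L + L) (s'.realMem 2 i)) ∧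
      ∀ j, k ≤ j → s'.realMem 2 j = 0)
    n ((L + L) * ((L + L) * 40 + 60) + 40) ⟨h12, by simp, fun j _ => h2 j⟩
    ?_ ?_ (fun s c h => h)).imp ?_
  · rintro k hk s₁ ⟨h12, hA, hB⟩ hf
    have e0 : s₁.natMem 0 0 = n := (hf.nat 0 (by decide) 0).trans hn
    have e1 : s₁.natMem 1 0 = L := (hf.nat 1 (by decide) 0).trans hL
    have e5 := hf.real 5 (by decide)
    refine ⟨by simp [Test.Holds, NExp.eval, e0, h12, hk], ?_⟩
    generalize hc : Test.size _ = c
    have hc8 : c = 5 := by rw [← hc]; rfl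
    let s₂ : State M := ((((s₁.tick c).writeNat 8 0 0).tick 3).writeNat
      9 0 (s₁.natMem 12 0)).tick 4
    obtain ⟨s₃, x₃, t₃, c₃, d₃⟩ := selectLoop_spec (ω := ω) s₂ L k (by simp [s₂, e0])
      (by simp [s₂, e1]) (by simp [s₂]) (by simp [s₂, h12]) (by simp [s₂, h12])
      (by simp [s₂, hB k le_rfl])
    have f₃ := x₃.frame
    refine ⟨_, .seq (.setNat _ _ _ _) (.seq (.setNat _ _ _ _) (.seq x₃ (.setNat _ _ _ _))),
      ?_, ?_, ?_, ?_⟩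
    · simp [s₂] at t₃
      simp [NExp.size]
      omega
    · simp [NExp.eval, f₃.nat 12 (by decide), s₂, h12]
    · intro i hik
      simp only [State.realMem_tick, State.realMem_writeNat]
      rcases Nat.lt_succ_iff_lt_or_eq.1 hik with hik | rfl
      · rw [d₃ _ hik.ne]
        exact hA i hik
      · simpa [s₂, e5] using c₃
    · intro j hj
      simp only [State.realMem_tick, State.realMem_writeNat]
      rw [d₃ _ (by omega)]
      exact hB j (by omega)
  · rintro s₁ ⟨h12, -⟩ hf
    simp [Test.Holds, NExp.eval, h12, hf.nat 0 (by decide) 0, hn]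
  · rintro s' ⟨he, htime, -, h, -⟩
    exact ⟨he, by simpa [Test.size, NExp.size] using htime, fun i => h i i.2⟩

/-! ### The choice of the parameters, and the whole program -/

theorem depthLoop_spec (s : State M) (m : ℕ) (hn : s.natMem 0 0 = n) (h1 : s.natMem 1 0 = 1)
    (h3 : s.realMem 3 0 = 1) (hm : (n : ℝ) * (1 / 2) ^ m ≤ s.realMem 1 0 * s.realMem 1 1)
    (hm' : ∀ k < m, s.realMem 1 0 * s.realMem 1 1 < n * (1 / 2) ^ k) :
    ∃ s', Exec M ω depthLoop s s' ∧ s'.time ≤ s.time + (m * 40 + 12) ∧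
      s'.natMem 1 0 = m + 1 := by
  refine (Exec.loop_of_invariant (ω := ω) (s₀ := s) (b := depthTest) (p := depthStep)
    (fun k s' => s'.natMem 1 0 = k + 1 ∧ s'.realMem 3 0 = (1 / 2) ^ k)
    m 40 ⟨h1, by simp [h3]⟩ ?_ ?_ (fun s c h => h)).imp ?_
  · rintro k hk s₁ ⟨h1, h3⟩ hf
    have e0 : s₁.natMem 0 0 = n := (hf.nat 0 (by decide) 0).trans hn
    refine ⟨?_, _, .seq (.setReal _ _ _ _) (.setNat _ _ _ _), ?_, ?_, ?_⟩
    · simpa [depthTest, Test.Holds, NExp.eval, RExp.eval, e0, h3, hf.real 1 (by decide)] using hm' k hk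
    · simp [depthTest, Test.size, NExp.size, RExp.size]
    · simp [NExp.eval, h1]
    · simp [NExp.eval, RExp.eval, h3]
      ring
  · rintro s₁ ⟨h1, h3⟩ hf
    have e0 : s₁.natMem 0 0 = n := (hf.nat 0 (by decide) 0).trans hn
    simpa [depthTest, Test.Holds, NExp.eval, RExp.eval, e0, h3, hf.real 1 (by decide)] using hm
  · rintro s' ⟨he, htime, h1, -⟩
    exact ⟨he, by simpa [depthTest, Test.size, NExp.size, RExp.size] using htime, h1⟩

/-- The number of samples per repetition. -/
noncomputable def sampleSize (V : ℝ → ℝ) (ε τ : ℝ) : ℕ := ⌈16 * (1 + V (ε * τ)) / (ε * ε)⌉₊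

/-- The machine cannot round, so the ceiling is found by counting up; `Nat.lt_ceil` is precisely the
loop test. -/
theorem sizeLoop_spec (s : State M) (ε τ : ℝ) (h3 : s.natMem 3 0 = 0) (hε : s.realMem 1 0 = ε)
    (hτ : s.realMem 1 1 = τ) :
    ∃ s', Exec M ω sizeLoop s s' ∧ s'.time ≤ s.time + (sampleSize M.bound ε τ * 40 + 20) ∧
      s'.natMem 3 0 = sampleSize M.bound ε τ := by
  refine (Exec.loop_of_invariant (ω := ω) (s₀ := s) (b := sizeTest) (p := incr 3)
    (fun k s' => s'.natMem 3 0 = k)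
    (sampleSize M.bound ε τ) 40 h3 ?_ ?_ (fun s c h => h)).imp ?_
  · rintro k hk s₁ h3 hf
    refine ⟨?_, _, .setNat _ _ _ _, ?_, ?_⟩
    · simpa [sizeTest, Test.Holds, NExp.eval, RExp.eval, h3, hf.real 1 (by decide), hε, hτ] using
        Nat.lt_ceil.1 hk
    · simp [sizeTest, Test.size, NExp.size, RExp.size]
    · simp [NExp.eval, h3]
  · rintro s₁ h3 hf
    have := Nat.le_ceil (16 * (1 + M.bound (ε * τ)) / (ε * ε))
    simpa [sizeTest, Test.Holds, NExp.eval, RExp.eval, h3, hf.real 1 (by decide), hε, hτ,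
      sampleSize] using this
  · rintro s' ⟨he, htime, h3⟩
    exact ⟨he, by simp [sizeTest, Test.size, NExp.size, RExp.size] at htime; omega, h3⟩

/-- The sum computed by repetition number `r`. -/
noncomputable def repSum (M : Env.{u, v, w} E n) (ω : ℕ → M.fam.Fn × unitInterval)
    (z : Fin n → ℝ) (L N : ℕ) (i : Fin n) (r : ℕ) : ℝ :=
  ∑ b ∈ Finset.range L, levelSum M ω z L N r i b

theorem IsSelected.congr {a a' : ℕ → ℝ} {R L : ℕ} {x : ℝ} (h : IsSelected a R L R x)
    (haa : ∀ r < R, a r = a' r) : IsSelected a' R L R x := by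
  have hc : ∀ x, countGE a R x = countGE a' R x := fun x => by
    unfold countGE
    congr 1
    exact Finset.filter_congr fun r hr => by rw [haa r (Finset.mem_range.1 hr)]
  refine ⟨h.mem.imp_right fun ⟨r, hr, hL, hx⟩ => ⟨r, hr, ?_, by rw [hx, haa r hr]⟩,
    fun r hr hL => ?_⟩
  · rw [← haa r hr]
    exact h.le r hr (by rwa [hc, haa r hr])
  · rwa [← hc, ← haa r hr]

theorem program_spec (z : Fin n → ℝ) (ε τ : ℝ) (m : ℕ) (hm : (n : ℝ) * (1 / 2) ^ m ≤ ε * τ)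
    (hm' : ∀ k < m, ε * τ < n * (1 / 2) ^ k) :
    ∃ s', Exec M ω program (initState M z ε τ) s' ∧
      s'.time ≤ m * 40 + sampleSize M.bound ε τ * 40 +
        (m + 1) * (n * 40 + (m + 1 + (m + 1)) *
          (sampleSize M.bound ε τ * (n * (M.cost + 40) + M.cost * n + 60) + 40) + 100) +
        n * ((m + 1 + (m + 1)) * ((m + 1 + (m + 1)) * 40 + 60) + 40) + 60 ∧
      ∀ i : Fin n, IsSelected (repSum M ω z (m + 1) (sampleSize M.bound ε τ) i)
        (m + 1 + (m + 1)) (m + 1) (m + 1 + (m + 1)) (output s' i) := by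
  set N := sampleSize M.bound ε τ with hN
  -- Literals evaluate to casts of rationals; this rewriting makes `s₁` and `s₄` the states that the
  -- machine reaches.
  have he (s : State M) : RExp.eval s (.lit 1) = 1 := by simp [RExp.eval]
  let s₁ : State M := ((((initState M z ε τ).writeNat 1 0 1).tick 3).writeReal 3 0 1).tick 3
  obtain ⟨s₂, x₂, t₂, l₂⟩ := depthLoop_spec (ω := ω) s₁ m (by simp [s₁, initState])
    (by simp [s₁]) (by simp [s₁]) (by simpa [s₁, initState] using hm)
    (by simpa [s₁, initState] using hm')
  have f₂ := x₂.frame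
  obtain ⟨s₃, x₃, t₃, l₃⟩ := sizeLoop_spec (ω := ω) s₂ ε τ
    (by simp [f₂.nat 3 (by decide), s₁, initState])
    (by simp [f₂.real 1 (by decide), s₁, initState])
    (by simp [f₂.real 1 (by decide), s₁, initState])
  have f₃ := x₃.frame
  rw [← hN] at l₃ t₃
  let s₄ : State M := (s₃.writeReal 3 0 1).tick 3
  obtain ⟨s₅, x₅, t₅, a₅⟩ := levelLoop_spec (ω := ω) s₄ z (m + 1) N
    (by simp [s₄, f₃.nat 0 (by decide), f₂.nat 0 (by decide), s₁, initState])
    (by simp [s₄, f₃.nat 1 (by decide), l₂])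
    (by simp [s₄, l₃])
    (by simp [s₄, f₃.nat 4 (by decide), f₂.nat 4 (by decide), s₁, initState])
    (by simp [s₄, f₃.nat 11 (by decide), f₂.nat 11 (by decide), s₁, initState])
    (by simp [s₄, f₃.tables rfl, f₂.tables rfl, s₁, initState])
    (by simp [s₄, f₃.draws rfl, f₂.draws rfl, s₁, initState])
    (by simp [s₄])
    (by simp [s₄, f₃.real 0 (by decide), f₂.real 0 (by decide), s₁, initState])
    (by simp [s₄, f₃.real 5 (by decide), f₂.real 5 (by decide), s₁, initState])
  have f₅ := x₅.frame
  let s₆ : State M := (s₅.writeNat 12 0 0).tick 3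
  obtain ⟨s₇, x₇, t₇, a₇⟩ := outLoop_spec (ω := ω) s₆ (m + 1)
    (by simp [s₆, f₅.nat 0 (by decide), s₄, f₃.nat 0 (by decide), f₂.nat 0 (by decide), s₁,
      initState])
    (by simp [s₆, f₅.nat 1 (by decide), s₄, f₃.nat 1 (by decide), l₂])
    (by simp [s₆])
    (by simp [s₆, f₅.real 2 (by decide), s₄, f₃.real 2 (by decide), f₂.real 2 (by decide), s₁,
      initState])
  refine ⟨s₇, .seq (.setNat _ _ _ _) (.seq ?_ (.seq x₂ (.seq x₃ (.seq ?_ (.seq x₅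
    (.seq (.setNat _ _ _ _) x₇)))))), ?_, fun i => ?_⟩
  · have := Exec.setReal (ω := ω) (((initState M z ε τ).writeNat 1 0 1).tick 3) 3 (.lit 0) (.lit 1)
    rw [he] at this
    exact this
  · have := Exec.setReal (ω := ω) s₃ 3 (.lit 0) (.lit 1)
    rw [he] at this
    exact this
  · simp [s₁, initState] at t₂
    simp [s₄] at t₅
    simp [s₆] at t₇
    omega
  · refine (a₇ i).congr fun r hr => ?_
    simpa [s₆, repSum] using a₅ r hr i

end Specs

end KMV

/-! ### Independence and amplification -/

section Independence

variable {Ω₀ : Type*} [MeasurableSpace Ω₀] (P : Measure Ω₀) [IsProbabilityMeasure P]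

/-- Functions of disjoint blocks of coordinates of an independent sequence are independent. -/
theorem iIndepFun_blocks {α ι κ β : Type*} [MeasurableSpace β] (f : ι → κ → α)
    (hf : Function.Injective fun p : (_ : ι) × κ => f p.1 p.2) (X : ι → (κ → Ω₀) → β)
    (hX : ∀ i, Measurable (X i)) :
    iIndepFun (fun i (ω : α → Ω₀) => X i fun k => ω (f i k)) (Measure.infinitePi fun _ => P) := by
  have hf' (i : ι) : Function.Injective (f i) := fun k k' h => by
    have := @hf ⟨i, k⟩ ⟨i, k'⟩ h
    simpa using this
  have key : iIndepFun (fun i (ω : α → Ω₀) k => ω (f i k)) (Measure.infinitePi fun _ => P) := by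
    rw [iIndepFun_iff_map_fun_eq_infinitePi_map (by fun_prop)]
    -- Restricting a product measure along an injection gives a product measure, and currying it
    -- gives a product of product measures. So the joint law of the blocks is the product of their
    -- laws.
    have h1 := Measure.map_infinitePi_infinitePi_of_inj (P := fun _ : α => P) hf
    have h2 := Measure.infinitePi_map_piCurry (X := fun (_ : ι) (_ : κ) => Ω₀) (fun _ _ => P)
    rw [← h1, Measure.map_map (by fun_prop) (by fun_prop)] at h2
    refine h2.trans ?_
    congr 1
    funext i
    exact (Measure.map_infinitePi_infinitePi_of_inj (P := fun _ : α => P) (hf' i)).symm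
  exact key.comp X hX

end Independence

open Classical in
/-- Among `R` independent events of probability at most `1 / 16` each, at least half occur with
probability at most `2 ^ (-R)`. -/
theorem measure_half_le {Ω : Type*} [MeasurableSpace Ω] {μ : Measure Ω} [IsProbabilityMeasure μ]
    {R : ℕ} (Y : Fin R → Ω → ℝ) (hY : ∀ r, Measurable (Y r)) (hind : iIndepFun Y μ)
    (B : Set ℝ) (hB : MeasurableSet B) (hp : ∀ r, μ.real (Y r ⁻¹' B) ≤ 1 / 16) :
    μ.real {ω | R ≤ 2 * (Finset.univ.filter fun r => Y r ω ∈ B).card} ≤ (1 / 2) ^ R := by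
  -- This is `16` to the power of the indicator of `B`, with mean at most `1 + 15/16 ≤ 2`. The
  -- product over `r` is `16^(number of events)`, which is at least `4^R` if half of them occur, so
  -- Markov's inequality gives `2^R / 4^R`.
  set f : ℝ → ℝ := fun y => 1 + B.indicator (fun _ => 15) y with hf
  have hfm : Measurable f := measurable_const.add (measurable_const.indicator hB)
  have hprod : ∫ ω, ∏ r, f (Y r ω) ∂μ = ∏ r, ∫ ω, f (Y r ω) ∂μ :=
    hind.integral_fun_prod_comp (f := fun _ => f) (fun r => (hY r).aemeasurable)
      fun r => hfm.aestronglyMeasurable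
  have hfac : ∀ r, ∫ ω, f (Y r ω) ∂μ ≤ 2 := fun r => by
    have : (fun ω => f (Y r ω)) = fun ω => 1 + (Y r ⁻¹' B).indicator (fun _ => (15 : ℝ)) ω := rfl
    rw [this, integral_add (integrable_const _)
      ((integrable_const _).indicator ((hY r) hB)), integral_indicator ((hY r) hB)]
    simp
    have := hp r
    simp at this
    linarith
  have hfpos : ∀ y, 1 ≤ f y := fun y => by
    simp only [hf, le_add_iff_nonneg_right]
    exact Set.indicator_nonneg (fun _ _ => by norm_num) y
  have hval : ∀ ω, ∏ r, f (Y r ω) = 16 ^ (Finset.univ.filter fun r => Y r ω ∈ B).card := by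
    intro ω
    rw [← Finset.prod_const, Finset.prod_filter]
    refine Finset.prod_congr rfl fun r _ => ?_
    by_cases h : Y r ω ∈ B <;> simp [hf, h]; norm_num
  have hint : Integrable (fun ω => ∏ r, f (Y r ω)) μ := by
    refine Integrable.of_bound (C := 16 ^ R) (Finset.measurable_prod _ fun r _ =>
      hfm.comp (hY r)).aestronglyMeasurable (.of_forall fun ω => ?_)
    rw [hval, Real.norm_of_nonneg (by positivity)]
    refine pow_le_pow_right₀ (by norm_num) ((Finset.card_filter_le _ _).trans (by simp))
  have hmarkov := mul_meas_ge_le_integral_of_nonneg (μ := μ)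
    (.of_forall fun ω => (Finset.prod_nonneg fun r _ => by linarith [hfpos (Y r ω)])) hint
    ((4 : ℝ) ^ R)
  rw [hprod] at hmarkov
  have h2 : ∏ r, ∫ ω, f (Y r ω) ∂μ ≤ 2 ^ R := by
    refine (Finset.prod_le_prod (fun r _ => ?_) fun r _ => hfac r).trans (by simp)
    exact integral_nonneg fun ω => zero_le_one.trans (hfpos (Y r ω))
  have hsub : {ω | R ≤ 2 * (Finset.univ.filter fun r => Y r ω ∈ B).card} ⊆
      {ω | (4 : ℝ) ^ R ≤ ∏ r, f (Y r ω)} := fun ω hω => by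
    simp only [Set.mem_ofPred_eq] at hω ⊢
    rw [hval]
    calc (4 : ℝ) ^ R ≤ 4 ^ (2 * (Finset.univ.filter fun r => Y r ω ∈ B).card) :=
          pow_le_pow_right₀ (by norm_num) hω
      _ = _ := by rw [pow_mul]; norm_num
  refine (measureReal_mono hsub).trans ?_
  have h5 : (4 : ℝ) ^ R = 2 ^ R * 2 ^ R := by rw [← mul_pow]; norm_num
  rw [div_pow, one_pow, le_div_iff₀ (by positivity)]
  refine le_of_mul_le_mul_left ?_ (pow_pos (two_pos (α := ℝ)) R)
  calc (2 : ℝ) ^ R * (μ.real {ω | (4 : ℝ) ^ R ≤ ∏ r, f (Y r ω)} * 2 ^ R)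
      = 4 ^ R * μ.real {ω | (4 : ℝ) ^ R ≤ ∏ r, f (Y r ω)} := by rw [h5]; ring
    _ ≤ 2 ^ R * 1 := by rw [mul_one]; exact hmarkov.trans h2

/-! ### Moments of the estimator -/

namespace HashFamily

variable {E : Type w} (F : HashFamily.{u, v, w} E) {ι : Type*}

theorem cell_map (pt : ι → E) (S : List ι) (h : F.Fn) (q : E) :
    F.cell id (S.map pt) h q = (F.cell pt S h q).map pt := by
  simp only [cell, List.filter_map]
  rfl

/-- Passes between lists of labels, which the machine uses, and lists of points, for which
`VBounded` is stated. -/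
theorem estimate_map (k : E → E → ℝ) (pt : ι → E) (S : List ι) (h : F.Fn) (r : unitInterval)
    (q : E) : F.estimate k id (S.map pt) h r q = F.estimate k pt S h r q := by
  simp only [estimate, draw, cell_map, List.length_map, List.getElem?_map]
  cases (F.cell pt S h q)[⌊(r : ℝ) * (F.cell pt S h q).length⌋₊]? <;> rfl

theorem estimate_nil (k : E → E → ℝ) (pt : ι → E) (h : F.Fn) (r : unitInterval) (q : E) :
    F.estimate k pt [] h r q = 0 := by
  simp [estimate, draw, cell]

/-- Only collision events are known to be measurable. They suffice: the hash function enters only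
through the set of labels colliding with `q`, an element of the finite type `Set ι`, and for each
such set the dependence on `r` is through a floor. -/
theorem measurable_estimate [Finite ι] (k : E → E → ℝ) (pt : ι → E) (S : List ι) (q : E) :
    Measurable fun ω : F.Fn × unitInterval => F.estimate k pt S ω.1 ω.2 q := by
  classical
  let G : Set ι × unitInterval → ℝ := fun p =>
    ((S.filter (· ∈ p.1))[⌊(p.2 : ℝ) * (S.filter (· ∈ p.1)).length⌋₊]?).elim 0 fun j =>
      k q (pt j) / F.collisionProb q (pt j) * ((S.filter (· ∈ p.1)).length / S.length)
  have hG : Measurable G := by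
    refine measurable_from_prod_countable_right fun A => ?_
    have h1 : Measurable fun r : unitInterval => ⌊(r : ℝ) * (S.filter (· ∈ A)).length⌋₊ :=
      Nat.measurable_floor.comp (measurable_subtype_coe.mul_const _)
    exact (measurable_from_nat (f := fun i : ℕ => ((S.filter (· ∈ A))[i]?).elim 0 fun j =>
      k q (pt j) / F.collisionProb q (pt j) * ((S.filter (· ∈ A)).length / S.length))).comp h1
  have hA : Measurable fun h : F.Fn => {j : ι | F.hash h (pt j) = F.hash h q} := by
    rw [measurable_set_iff]
    exact fun j => measurable_to_prop (by
      convert F.measurableSet_collision (pt j) q using 1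
      ext h
      simp)
  have : (fun ω : F.Fn × unitInterval => F.estimate k pt S ω.1 ω.2 q) =
      G ∘ fun ω => ({j : ι | F.hash ω.1 (pt j) = F.hash ω.1 q}, ω.2) := by
    funext ω
    simp only [G, Function.comp, estimate, draw, cell, Set.mem_ofPred_eq]
  rw [this]
  exact hG.comp ((hA.comp measurable_fst).prodMk measurable_snd)

/-- With finitely many labels the estimator is bounded. This supplies the square integrability
needed for variances, which the integral conditions in `VBounded` do not assert. -/
theorem abs_estimate_le [Fintype ι] (k : E → E → ℝ) (pt : ι → E) (S : List ι) (h : F.Fn)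
    (r : unitInterval) (q : E) :
    |F.estimate k pt S h r q| ≤ ∑ j, |k q (pt j) / F.collisionProb q (pt j)| := by
  unfold estimate
  rcases F.draw pt S h r q with _ | j
  · simpa using Finset.sum_nonneg fun _ _ => abs_nonneg _
  · have hle : ((F.cell pt S h q).length : ℝ) / S.length ≤ 1 :=
      div_le_one_of_le₀ (by exact_mod_cast List.length_filter_le _ _) (by positivity)
    have h0 : 0 ≤ ((F.cell pt S h q).length : ℝ) / S.length := by positivity
    simp only [Option.elim_some]
    rw [abs_mul, abs_of_nonneg h0]
    exact (mul_le_of_le_one_right (abs_nonneg _) hle).trans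
      (Finset.single_le_sum (f := fun j => |k q (pt j) / F.collisionProb q (pt j)|)
        (fun _ _ => abs_nonneg _) (Finset.mem_univ j))

theorem memLp_estimate [Fintype ι] (k : E → E → ℝ) (pt : ι → E) (S : List ι) (q : E) :
    MemLp (fun ω : F.Fn × unitInterval => F.estimate k pt S ω.1 ω.2 q) 2
      (F.law.prod (volume : Measure unitInterval)) :=
  MemLp.of_bound (F.measurable_estimate k pt S q).aestronglyMeasurable _
    (.of_forall fun ω => (Real.norm_eq_abs _).trans_le (F.abs_estimate_le k pt S ω.1 ω.2 q))

end HashFamily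

namespace VBounded

variable {E : Type w} [PseudoMetricSpace E] {F : HashFamily.{u, v, w} E} {k : E → E → ℝ}
  {V : ℝ → ℝ} {R : ℝ} {n : ℕ} {x : Fin n → E} {S : List (Fin n)}

theorem diam_le (hd : Metric.diam (Set.range x) ≤ R) (S : List (Fin n)) (i : Fin n) :
    Metric.diam (insert (x i) {y | y ∈ S.map x}) ≤ R := by
  refine (Metric.diam_mono ?_ (Set.finite_range x).isBounded).trans hd
  rintro y (rfl | hy)
  · exact ⟨i, rfl⟩
  · obtain ⟨j, -, rfl⟩ := List.mem_map.1 hy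
    exact ⟨j, rfl⟩

theorem integral_estimate (hV : VBounded F k V R n) (hx : Function.Injective x)
    (hd : Metric.diam (Set.range x) ≤ R) (hS : S.Nodup) (i : Fin n) :
    ∫ ω, F.estimate k x S ω.1 ω.2 (x i) ∂(F.law.prod (volume : Measure unitInterval)) =
      density k (S.map x) (x i) := by
  -- A level may be empty, a case that `VBounded` excludes; then both sides are `0`, as `0 / 0 = 0`.
  rcases eq_or_ne S [] with rfl | h
  · simp [F.estimate_nil, density]
  · rw [← hV.unbiased (S.map x) (by simpa) (hS.map hx)
      (by simpa using hS.length_le_card.trans_eq (Fintype.card_fin n)) (x i) (diam_le hd S i)]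
    simp only [F.estimate_map]

/-- The second moment of the estimator in terms of the values of `V` at a fixed point `t`. -/
theorem integral_estimate_sq_le (hV : VBounded F k V R n) (hk : ∀ a b, k a b ∈ Set.Icc (0 : ℝ) 1)
    (hx : Function.Injective x) (hd : Metric.diam (Set.range x) ≤ R) (hS : S.Nodup) (i : Fin n)
    {t : ℝ} (ht : t ∈ Set.Ioc (0 : ℝ) 1) :
    ∫ ω, F.estimate k x S ω.1 ω.2 (x i) ^ 2 ∂(F.law.prod (volume : Measure unitInterval)) ≤
      (density k (S.map x) (x i) ^ 2 + t ^ 2) * V t := by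
  have hVt := hV.nonneg t ht
  rcases eq_or_ne S [] with rfl | h
  · simp only [F.estimate_nil]
    simp only [ne_eq, OfNat.ofNat_ne_zero, not_false_eq_true, zero_pow, integral_zero]
    positivity
  · set q := density k (S.map x) (x i) with hq
    have h1 : ∫ ω, F.estimate k x S ω.1 ω.2 (x i) ^ 2
        ∂(F.law.prod (volume : Measure unitInterval)) ≤ q ^ 2 * V q := by
      rw [hq]
      refine le_trans (le_of_eq ?_) (hV.second_moment (S.map x) (by simpa) (hS.map hx)
        (by simpa using hS.length_le_card.trans_eq (Fintype.card_fin n)) (x i) (diam_le hd S i))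
      simp only [F.estimate_map]
    refine h1.trans ?_
    have hq0 : 0 ≤ q := div_nonneg (List.sum_nonneg fun a ha => by
      obtain ⟨b, -, rfl⟩ := List.mem_map.1 ha
      exact (hk _ _).1) (by positivity)
    have hq1 : q ≤ 1 := by
      refine div_le_one_of_le₀ ?_ (by positivity)
      have := List.sum_le_card_nsmul ((S.map x).map (k (x i))) 1 fun a ha => by
        obtain ⟨b, -, rfl⟩ := List.mem_map.1 ha
        exact (hk _ _).2
      simpa using this
    -- At density `0` nothing is known about `V 0`, but its factor vanishes.
    rcases hq0.eq_or_lt with h0 | h0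
    · rw [← h0]
      simp
      positivity
    -- Above `t`, `V q ≤ V t`; below `t`, `q^2 V q ≤ t^2 V t`.
    · rcases le_total t q with htq | htq
      · have := hV.antitone ht ⟨h0, hq1⟩ htq
        nlinarith [mul_le_mul_of_nonneg_left this (sq_nonneg q), mul_nonneg (sq_nonneg t) hVt]
      · have := hV.monotone ⟨h0, hq1⟩ ht htq
        simp only at this
        nlinarith [mul_nonneg (sq_nonneg q) hVt]

end VBounded

namespace KMV

/-! ### Binary digits: arithmetic -/

section Digits

variable {n : ℕ}

theorem nodup_level (z : Fin n → ℝ) (b : ℕ) : (level z b).Nodup :=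
  (List.nodup_finRange n).filter _

theorem sum_map_filter {ι : Type*} (l : List ι) (p : ι → Prop) [DecidablePred p] (φ : ι → ℝ) :
    ((l.filter fun j => p j).map φ).sum = (l.map fun j => if p j then φ j else 0).sum := by
  induction l with
  | nil => rfl
  | cons a l ih => by_cases h : p a <;> simp [h, ih]

/-- Greedy expansion: a residual at most twice the next digit value stays at most that value,
whether or not it is subtracted. Digit `0` has value `1`, so after `m + 1` digits at most `2^(-m)`
is left. -/
theorem residual_mem {z : Fin n → ℝ} (h0 : ∀ i, 0 ≤ z i) (h1 : ∀ i, z i ≤ 1) (b : ℕ) (j : Fin n) :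
    0 ≤ residual z b j ∧ residual z b j ≤ 2 * (1 / 2) ^ b := by
  induction b with
  | zero => exact ⟨h0 j, by simpa [residual] using (h1 j).trans one_le_two⟩
  | succ b ih =>
    have : (2 : ℝ) * (1 / 2) ^ (b + 1) = (1 / 2) ^ b := by ring
    simp only [residual]
    rw [this]
    split_ifs with h
    · constructor <;> linarith
    · exact ⟨ih.1, (not_le.1 h).le⟩

/-- The digit values of a weight telescope to `z - residual`. It is used with `φ = 1` for the total
weight and with a row of the kernel matrix for the truncated product. -/
theorem sum_level (z φ : Fin n → ℝ) (L : ℕ) :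
    ∑ b ∈ Finset.range L, (1 / 2) ^ b * ((level z b).map φ).sum =
      ∑ j, φ j * (z j - residual z L j) := by
  classical
  induction L with
  | zero => simp [residual]
  | succ L ih =>
    rw [Finset.sum_range_succ, ih, level, sum_map_filter, ← Fin.sum_univ_def, Finset.mul_sum,
      ← Finset.sum_add_distrib]
    refine Finset.sum_congr rfl fun j _ => ?_
    simp only [residual]
    split_ifs <;> ring

theorem sum_weight_le_one {z : Fin n → ℝ} (h0 : ∀ i, 0 ≤ z i) (hz : ∑ i, z i = 1) (L : ℕ) :
    ∑ b ∈ Finset.range L, (1 / 2 : ℝ) ^ b * (level z b).length ≤ 1 := by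
  have h1 : ∀ i, z i ≤ 1 := fun i => by
    rw [← hz]
    exact Finset.single_le_sum (fun j _ => h0 j) (Finset.mem_univ i)
  have := sum_level z (fun _ => 1) L
  simp only [List.map_const', List.sum_replicate, nsmul_eq_mul, mul_one, one_mul] at this
  rw [this, ← hz]
  exact Finset.sum_le_sum fun j _ => by linarith [(residual_mem h0 h1 L j).1]

end Digits

/-! ### One repetition -/

section Repetition

variable {E : Type w} {n : ℕ} (M : Env.{u, v, w} E n)

/-- The position on the tape used for sample `l` of repetition `r` for digit `b`: by the table
(`false`) and by the query at the point `i` (`true`). -/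
def tapeIndex (n L N i r b l : ℕ) (t : Bool) : ℕ :=
  (b * ((L + L) * N) + r * N + l) * (n + 1) + cond t (1 + i) 0

theorem add_mul_inj {N a a' l l' : ℕ} (hl : l < N) (hl' : l' < N)
    (h : a * N + l = a' * N + l') : a = a' ∧ l = l' := by
  have hN : 0 < N := by omega
  have h1 := congrArg (· / N) h
  have h2 := congrArg (· % N) h
  simp only [mul_comm _ N, Nat.mul_add_div hN, Nat.div_eq_of_lt hl, Nat.div_eq_of_lt hl',
    Nat.mul_add_mod, Nat.mod_eq_of_lt hl, Nat.mod_eq_of_lt hl'] at h1 h2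
  exact ⟨by omega, h2⟩

/-- The position is a mixed-radix number with digits `b`, `r`, `l` and the offset within a sample,
in bases `2L`, `N`, `n + 1`; the leading digit `b` needs no bound. -/
theorem tapeIndex_inj {n L N i r b l r' b' l' : ℕ} {t t' : Bool} (hi : i < n) (hr : r < L + L)
    (hr' : r' < L + L) (hl : l < N) (hl' : l' < N)
    (h : tapeIndex n L N i r b l t = tapeIndex n L N i r' b' l' t') :
    b = b' ∧ r = r' ∧ l = l' ∧ t = t' := by
  obtain ⟨h1, h2⟩ := add_mul_inj (by grind) (by grind) h
  have h3 : (b * (L + L) + r) * N + l = (b' * (L + L) + r') * N + l' := by linarith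
  obtain ⟨h4, h5⟩ := add_mul_inj hl hl' h3
  obtain ⟨h6, h7⟩ := add_mul_inj hr hr' h4
  refine ⟨h6, h7, h5, ?_⟩
  grind

/-- One summand of the result of a repetition. -/
noncomputable def term (z : Fin n → ℝ) (L N : ℕ) (i : Fin n) (r b l : ℕ)
    (ω : ℕ → M.fam.Fn × unitInterval) : ℝ :=
  coef z N b * M.fam.estimate M.ker M.pt (level z b) (ω (tapeIndex n L N i r b l false)).1
    (ω (tapeIndex n L N i r b l true)).2 (M.pt i)

theorem repSum_eq (z : Fin n → ℝ) (L N : ℕ) (i : Fin n) (r : ℕ)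
    (ω : ℕ → M.fam.Fn × unitInterval) :
    repSum M ω z L N i r = ∑ p : Fin L × Fin N, term M z L N i r p.1 p.2 ω := by
  rw [Fintype.sum_prod_type, repSum, Finset.sum_range]
  refine Finset.sum_congr rfl fun b _ => ?_
  simp only [levelSum, Finset.sum_range, term, tapeIndex, cond_false, cond_true, add_zero, add_assoc]

theorem measurable_sample (S : List (Fin n)) (q : E) (c : ℝ) :
    Measurable fun ω : M.fam.Fn × unitInterval =>
      c * M.fam.estimate M.ker M.pt S ω.1 ω.2 q :=
  (M.fam.measurable_estimate M.ker M.pt S q).const_mul c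

theorem measurable_fst_snd {α β κ : Type*} [MeasurableSpace α] [MeasurableSpace β] (a b : κ) :
    Measurable fun u : κ → α × β => ((u a).1, (u b).2) := by
  fun_prop

/-- The point `i` is fixed: its repetitions read disjoint tape entries, whereas different points
share the entries of the tables. -/
theorem iIndepFun_repSum (z : Fin n → ℝ) (L N : ℕ) (i : Fin n) :
    iIndepFun (fun (r : Fin (L + L)) ω => repSum M ω z L N i r) M.fam.tapeLaw := by
  have := iIndepFun_blocks (M.fam.law.prod (volume : Measure unitInterval))
    (fun (r : Fin (L + L)) (q : (Fin L × Fin N) × Bool) =>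
      tapeIndex n L N i r q.1.1 q.1.2 q.2)
    (by
      rintro ⟨r, ⟨b, l⟩, t⟩ ⟨r', ⟨b', l'⟩, t'⟩ h
      obtain ⟨h1, h2, h3, h4⟩ := tapeIndex_inj i.2 r.2 r'.2 l.2 l'.2 h
      simp only [Sigma.mk.injEq, heq_eq_eq, Prod.mk.injEq]
      exact ⟨Fin.ext h2, ⟨Fin.ext h1, Fin.ext h3⟩, h4⟩)
    (fun _ u => ∑ p : Fin L × Fin N, coef z N p.1 * M.fam.estimate M.ker M.pt (level z p.1)
      (u (p, false)).1 (u (p, true)).2 (M.pt i))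
    (fun _ => Finset.measurable_sum _ fun p _ =>
      (measurable_sample M (level z p.1) (M.pt i) (coef z N p.1)).comp
        (measurable_fst_snd (p, false) (p, true)))
  refine (iIndepFun_congr fun r => .of_forall fun ω => ?_).1 this
  exact (repSum_eq M z L N i r ω).symm

theorem iIndepFun_term (z : Fin n → ℝ) (L N : ℕ) (i : Fin n) (r : Fin (L + L)) :
    iIndepFun (fun p : Fin L × Fin N => term M z L N i r p.1 p.2) M.fam.tapeLaw :=
  iIndepFun_blocks (M.fam.law.prod (volume : Measure unitInterval))
    (fun (p : Fin L × Fin N) (t : Bool) => tapeIndex n L N i r p.1 p.2 t)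
    (by
      rintro ⟨⟨b, l⟩, t⟩ ⟨⟨b', l'⟩, t'⟩ h
      obtain ⟨h1, h2, h3, h4⟩ := tapeIndex_inj i.2 r.2 r.2 l.2 l'.2 h
      simp only [Sigma.mk.injEq, heq_eq_eq, Prod.mk.injEq]
      exact ⟨⟨Fin.ext h1, Fin.ext h3⟩, h4⟩)
    (fun p u => coef z N p.1 * M.fam.estimate M.ker M.pt (level z p.1)
      (u false).1 (u true).2 (M.pt i))
    (fun p => (measurable_sample M (level z p.1) (M.pt i) (coef z N p.1)).comp
        (measurable_fst_snd false true))

/-- The hash function and the uniform number of a query come from two different tape entries; by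
independence the pair is distributed like a single entry. -/
theorem measurePreserving_sample (F : HashFamily.{u, v, w} E) {a b : ℕ} (hab : a ≠ b) :
    MeasurePreserving (fun ω : ℕ → F.Fn × unitInterval => ((ω a).1, (ω b).2)) F.tapeLaw
      (F.law.prod (volume : Measure unitInterval)) := by
  have h1 := Measure.infinitePi_map_eval_prod
    (P := fun _ : ℕ => F.law.prod (volume : Measure unitInterval)) hab
  refine ⟨by fun_prop, ?_⟩
  have h2 : (fun ω : ℕ → F.Fn × unitInterval => ((ω a).1, (ω b).2)) =
      Prod.map Prod.fst Prod.snd ∘ fun ω => (ω a, ω b) := rfl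
  rw [h2, ← Measure.map_map (by fun_prop) (by fun_prop), HashFamily.tapeLaw, h1,
    ← Measure.map_prod_map _ _ measurable_fst measurable_snd]
  simp

instance (F : HashFamily.{u, v, w} E) : IsProbabilityMeasure F.tapeLaw := by
  unfold HashFamily.tapeLaw
  infer_instance

theorem tapeIndex_ne (n L N i r b l : ℕ) :
    tapeIndex n L N i r b l false ≠ tapeIndex n L N i r b l true := by
  simp only [tapeIndex, cond_false, cond_true]
  omega

theorem memLp_term (z : Fin n → ℝ) (L N : ℕ) (i : Fin n) (r b l : ℕ) :
    MemLp (term M z L N i r b l) 2 M.fam.tapeLaw :=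
  ((M.fam.memLp_estimate M.ker M.pt (level z b) (M.pt i)).comp_measurePreserving
    (measurePreserving_sample M.fam (tapeIndex_ne n L N i r b l))).const_mul (coef z N b)

theorem integral_term (z : Fin n → ℝ) (L N : ℕ) (i : Fin n) (r b l : ℕ) :
    ∫ ω, term M z L N i r b l ω ∂M.fam.tapeLaw = coef z N b *
      ∫ ω, M.fam.estimate M.ker M.pt (level z b) ω.1 ω.2 (M.pt i)
        ∂(M.fam.law.prod (volume : Measure unitInterval)) := by
  have hp := measurePreserving_sample M.fam (tapeIndex_ne n L N i r b l)
  rw [← hp.map_eq, integral_map hp.measurable.aemeasurable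
    (M.fam.measurable_estimate _ _ _ _).aestronglyMeasurable, ← integral_const_mul]
  rfl

theorem integral_term_sq (z : Fin n → ℝ) (L N : ℕ) (i : Fin n) (r b l : ℕ) :
    ∫ ω, term M z L N i r b l ω ^ 2 ∂M.fam.tapeLaw = coef z N b ^ 2 *
      ∫ ω, M.fam.estimate M.ker M.pt (level z b) ω.1 ω.2 (M.pt i) ^ 2
        ∂(M.fam.law.prod (volume : Measure unitInterval)) := by
  have hp := measurePreserving_sample M.fam (tapeIndex_ne n L N i r b l)
  rw [← hp.map_eq, integral_map hp.measurable.aemeasurable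
    ((M.fam.measurable_estimate _ _ _ _).pow_const 2).aestronglyMeasurable, ← integral_const_mul]
  simp only [term, mul_pow]

/-- The matrix-vector product with all but the first `L` binary digits of `z` dropped. -/
noncomputable def truncated (z : Fin n → ℝ) (L : ℕ) (i : Fin n) : ℝ :=
  ∑ b ∈ Finset.range L, (1 / 2) ^ b * ((level z b).map fun j => M.ker (M.pt i) (M.pt j)).sum

theorem length_mul_density (k : E → E → ℝ) (x : Fin n → E) (S : List (Fin n)) (q : E) :
    S.length * density k (S.map x) q = (S.map fun j => k q (x j)).sum := by
  rcases eq_or_ne S [] with rfl | h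
  · simp
  · have : (S.length : ℝ) ≠ 0 := by simpa using h
    rw [density, List.map_map, List.length_map, mul_div_cancel₀ _ this]
    rfl

variable [PseudoMetricSpace E] {M} {D ε τ : ℝ} {z : Fin n → ℝ}

theorem integral_repSum (hV : VBounded M.fam M.ker M.bound D n) (hx : Function.Injective M.pt)
    (hd : Metric.diam (Set.range M.pt) ≤ D) (z : Fin n → ℝ) {L N : ℕ} (hN : 0 < N) (i : Fin n)
    (r : ℕ) :
    ∫ ω, repSum M ω z L N i r ∂M.fam.tapeLaw = truncated M z L i := by
  simp only [repSum_eq]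
  rw [integral_finsetSum _ fun p _ => (memLp_term M z L N i r p.1 p.2).integrable one_le_two,
    Fintype.sum_prod_type, truncated, Finset.sum_range]
  refine Finset.sum_congr rfl fun b _ => ?_
  simp only [integral_term, hV.integral_estimate hx hd (nodup_level z b) i, Finset.sum_const,
    Finset.card_univ, Fintype.card_fin, nsmul_eq_mul]
  rw [← length_mul_density, coef]
  have : (N : ℝ) ≠ 0 := by exact_mod_cast hN.ne'
  field_simp

/-- Variances of independent terms add, and each is at most its second moment `(u_b^2 + t^2 a_b^2)
V(t) / N^2`. Here `u_b` is the contribution of the digit to the truncated product and `a_b = 2^(-b)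
|S_b|`. Sums of squares are at most squares of sums, the `u_b` add up to the truncated product, and
the `a_b` to at most `1`. -/
theorem variance_repSum_le (hV : VBounded M.fam M.ker M.bound D n)
    (hk : ∀ a b, M.ker a b ∈ Set.Icc (0 : ℝ) 1) (hx : Function.Injective M.pt)
    (hd : Metric.diam (Set.range M.pt) ≤ D) (h0 : ∀ i, 0 ≤ z i) (hz : ∑ i, z i = 1) {t : ℝ}
    (ht : t ∈ Set.Ioc (0 : ℝ) 1) {L N : ℕ} (hN : 0 < N) (i : Fin n) (r : Fin (L + L)) :
    Var[fun ω => repSum M ω z L N i r; M.fam.tapeLaw] ≤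
      M.bound t / N * (truncated M z L i + t) ^ 2 := by
  have hNR : (0 : ℝ) < N := by exact_mod_cast hN
  have hVt := hV.nonneg t ht
  set u : ℕ → ℝ := fun b =>
    (1 / 2) ^ b * ((level z b).map fun j => M.ker (M.pt i) (M.pt j)).sum with hu
  set a : ℕ → ℝ := fun b => (1 / 2) ^ b * (level z b).length with ha
  have hu0 : ∀ b, 0 ≤ u b := fun b => mul_nonneg (by positivity) <| List.sum_nonneg fun y hy => by
    obtain ⟨j, -, rfl⟩ := List.mem_map.1 hy
    exact (hk _ _).1
  have ha0 : ∀ b, 0 ≤ a b := fun b => by positivity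
  have hterm : ∀ (p : Fin L × Fin N), Var[term M z L N i r p.1 p.2; M.fam.tapeLaw] ≤
      (u p.1 ^ 2 + t ^ 2 * a p.1 ^ 2) * M.bound t / N ^ 2 := fun p => by
    refine (variance_le_expectation_sq
      (memLp_term M z L N i r p.1 p.2).aestronglyMeasurable).trans ?_
    simp only [Pi.pow_apply]
    rw [integral_term_sq]
    refine (mul_le_mul_of_nonneg_left (hV.integral_estimate_sq_le hk hx hd
      (nodup_level z p.1) i ht) (sq_nonneg _)).trans_eq ?_
    simp only [hu, ha, ← length_mul_density, coef]
    field_simp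
  have hsum : (fun ω => repSum M ω z L N i r) =
      ∑ p : Fin L × Fin N, term M z L N i r p.1 p.2 := by
    funext ω
    rw [repSum_eq, Finset.sum_apply]
  rw [hsum, IndepFun.variance_sum (fun p _ => memLp_term M z L N i r p.1 p.2)
    fun p _ q _ hpq => (iIndepFun_term M z L N i r).indepFun hpq]
  calc ∑ p : Fin L × Fin N, Var[term M z L N i r p.1 p.2; M.fam.tapeLaw]
      ≤ ∑ p : Fin L × Fin N, (u p.1 ^ 2 + t ^ 2 * a p.1 ^ 2) * M.bound t / N ^ 2 :=
        Finset.sum_le_sum fun p _ => hterm p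
    _ = M.bound t / N *
        (∑ b ∈ Finset.range L, u b ^ 2 + t ^ 2 * ∑ b ∈ Finset.range L, a b ^ 2) := by
        rw [Fintype.sum_prod_type]
        simp only [Finset.sum_const, Finset.card_univ, Fintype.card_fin, nsmul_eq_mul]
        rw [Finset.mul_sum, ← Finset.sum_add_distrib, Finset.mul_sum, Finset.sum_range]
        refine Finset.sum_congr rfl fun b _ => ?_
        field_simp
    _ ≤ M.bound t / N * (truncated M z L i + t) ^ 2 := by
        refine mul_le_mul_of_nonneg_left ?_ (by positivity)
        have h1 : ∑ b ∈ Finset.range L, u b ^ 2 ≤ truncated M z L i ^ 2 :=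
          Finset.sum_sq_le_sq_sum_of_nonneg fun b _ => hu0 b
        have h2 : ∑ b ∈ Finset.range L, a b ^ 2 ≤ 1 := by
          refine (Finset.sum_sq_le_sq_sum_of_nonneg fun b _ => ha0 b).trans ?_
          exact pow_le_one₀ (Finset.sum_nonneg fun b _ => ha0 b) (sum_weight_le_one h0 hz L)
        have h3 : 0 ≤ truncated M z L i := Finset.sum_nonneg fun b _ => hu0 b
        nlinarith [mul_le_mul_of_nonneg_left h2 (sq_nonneg t), mul_nonneg h3 ht.1.le]

end Repetition

/-! ### The output -/

open Classical in
-- Fewer than `L` values are bad, so more than `L` are good. The smallest good value is a candidate,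
-- which bounds `x` from below. If `x` exceeded `y + δ`, the at least `L` values not below `x` would
-- all be bad. The default `x = 0` is covered by `0 ≤ y`.
theorem IsSelected.abs_sub_le {a : ℕ → ℝ} {L : ℕ} {x y δ : ℝ}
    (h : IsSelected a (L + L) L (L + L) x) (hy : 0 ≤ y) (hδ : 0 ≤ δ)
    (hbad : 2 * (Finset.univ.filter fun r : Fin (L + L) => δ ≤ |a r - y|).card < L + L) :
    |x - y| ≤ δ := by
  have hbad' : ((Finset.range (L + L)).filter fun r => δ ≤ |a r - y|).card < L := by
    have : ((Finset.range (L + L)).filter fun r => δ ≤ |a r - y|).card =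
        (Finset.univ.filter fun r : Fin (L + L) => δ ≤ |a r - y|).card := by
      rw [Finset.card_filter, Finset.card_filter, Finset.sum_range]
    omega
  set G := (Finset.range (L + L)).filter fun r => ¬ δ ≤ |a r - y| with hG
  have hGcard : L < G.card := by
    have : ((Finset.range (L + L)).filter fun r => δ ≤ |a r - y|).card + G.card = L + L := by
      rw [hG]
      convert Finset.card_filter_add_card_filter_not (s := Finset.range (L + L))
        (fun r => δ ≤ |a r - y|)
      exact (Finset.card_range _).symm
    omega
  obtain ⟨g, hg, hmin⟩ := Finset.exists_min_image G a (Finset.card_pos.1 (by omega))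
  obtain ⟨hgR, hgδ⟩ := Finset.mem_filter.1 hg
  have hge : a g ≤ x := h.le g (Finset.mem_range.1 hgR) <| hGcard.le.trans <|
    Finset.card_le_card fun r hr =>
      Finset.mem_filter.2 ⟨(Finset.mem_filter.1 hr).1, hmin r hr⟩
  have hle : x ≤ y + δ := by
    rcases h.mem with rfl | ⟨r, -, hL, rfl⟩
    · linarith
    · by_contra! hlt
      refine absurd (hL.trans (Finset.card_le_card fun r' hr' => ?_)) (not_le.2 hbad')
      obtain ⟨h1, h2⟩ := Finset.mem_filter.1 hr'
      exact Finset.mem_filter.2 ⟨h1, le_trans (by linarith) (le_abs_self _)⟩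
  have := (abs_lt.1 (not_le.1 hgδ)).1
  rw [abs_le]
  constructor <;> linarith

section Analysis

variable {E : Type w} {n : ℕ} {M : Env.{u, v, w} E n} {D ε τ : ℝ}
  {z : Fin n → ℝ}

theorem sampleSize_ge (V : ℝ → ℝ) (hε : 0 < ε) :
    16 * (1 + V (ε * τ)) ≤ ε ^ 2 * sampleSize V ε τ := by
  have := Nat.le_ceil (16 * (1 + V (ε * τ)) / (ε * ε))
  rw [div_le_iff₀ (by positivity)] at this
  rw [sampleSize]
  linarith

theorem truncated_nonneg (hk : ∀ a b, M.ker a b ∈ Set.Icc (0 : ℝ) 1) (z : Fin n → ℝ) (L : ℕ)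
    (i : Fin n) : 0 ≤ truncated M z L i :=
  Finset.sum_nonneg fun b _ => mul_nonneg (by positivity) <| List.sum_nonneg fun y hy => by
    obtain ⟨j, -, rfl⟩ := List.mem_map.1 hy
    exact (hk _ _).1

theorem measurable_repSum (z : Fin n → ℝ) (L N : ℕ) (i : Fin n) (r : ℕ) :
    Measurable fun ω => repSum M ω z L N i r := by
  simp only [repSum_eq]
  exact Finset.measurable_sum _ fun p _ => (measurable_sample M (level z p.1) (M.pt i) _).comp
    (measurable_fst_snd (tapeIndex n L N i r p.1 p.2 false) (tapeIndex n L N i r p.1 p.2 true))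

theorem truncated_eq (z : Fin n → ℝ) (L : ℕ) (i : Fin n) :
    truncated M z L i = ∑ j, M.ker (M.pt i) (M.pt j) * (z j - residual z L j) :=
  sum_level z (fun j => M.ker (M.pt i) (M.pt j)) L

theorem truncated_le (hk : ∀ a b, M.ker a b ∈ Set.Icc (0 : ℝ) 1) (h0 : ∀ i, 0 ≤ z i)
    (h1 : ∀ i, z i ≤ 1) (L : ℕ) (i : Fin n) :
    truncated M z L i ≤ ∑ j, M.ker (M.pt i) (M.pt j) * z j := by
  rw [truncated_eq]
  refine Finset.sum_le_sum fun j _ => mul_le_mul_of_nonneg_left ?_ (hk _ _).1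
  linarith [(residual_mem h0 h1 L j).1]

theorem le_truncated_add (hk : ∀ a b, M.ker a b ∈ Set.Icc (0 : ℝ) 1) (h0 : ∀ i, 0 ≤ z i)
    (h1 : ∀ i, z i ≤ 1) (m : ℕ) (i : Fin n) :
    ∑ j, M.ker (M.pt i) (M.pt j) * z j ≤ truncated M z (m + 1) i + n * (1 / 2) ^ m := by
  have : (n : ℝ) * (1 / 2) ^ m = ∑ j : Fin n, (1 / 2 : ℝ) ^ m := by simp
  rw [truncated_eq, this, ← Finset.sum_add_distrib]
  refine Finset.sum_le_sum fun j _ => ?_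
  obtain ⟨h2, h3⟩ := residual_mem h0 h1 (m + 1) j
  have h4 : (2 : ℝ) * (1 / 2) ^ (m + 1) = (1 / 2) ^ m := by ring
  nlinarith [(hk (M.pt i) (M.pt j)).2]

variable [PseudoMetricSpace E]

/-- A single repetition is inaccurate with probability at most `1 / 16`. -/
theorem measure_repSum_le (hV : VBounded M.fam M.ker M.bound D n)
    (hk : ∀ a b, M.ker a b ∈ Set.Icc (0 : ℝ) 1) (hx : Function.Injective M.pt)
    (hd : Metric.diam (Set.range M.pt) ≤ D) (h0 : ∀ i, 0 ≤ z i) (hz : ∑ i, z i = 1)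
    (hε : 0 < ε) (ht : ε * τ ∈ Set.Ioc (0 : ℝ) 1) (L : ℕ) (i : Fin n) (r : Fin (L + L)) :
    M.fam.tapeLaw.real {ω | ε * (truncated M z L i + ε * τ) ≤
      |repSum M ω z L (sampleSize M.bound ε τ) i r - truncated M z L i|} ≤ 1 / 16 := by
  set N := sampleSize M.bound ε τ with hNdef
  set y := truncated M z L i with hy
  have hy0 : 0 ≤ y := truncated_nonneg hk z L i
  have hVt := hV.nonneg _ ht
  have hNge := sampleSize_ge (τ := τ) M.bound hε
  rw [← hNdef] at hNge
  -- The summand `1` in `1 + V` ensures this even if `V` vanishes at `ετ`.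
  have hN : 0 < N := by
    rcases Nat.eq_zero_or_pos N with h | h
    · rw [h] at hNge
      simp at hNge
      linarith
    · exact h
  have hNR : (0 : ℝ) < N := by exact_mod_cast hN
  have hc : 0 < ε * (y + ε * τ) := mul_pos hε (by linarith [ht.1])
  have hmem : MemLp (fun ω => repSum M ω z L N i r) 2 M.fam.tapeLaw := by
    simp only [repSum_eq]
    exact memLp_finsetSum _ fun p _ => memLp_term M z L N i r p.1 p.2
  have hcheb := meas_ge_le_variance_div_sq hmem hc
  rw [integral_repSum hV hx hd z hN i r, ← hy] at hcheb
  have hvar := variance_repSum_le hV hk hx hd h0 hz ht hN i r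
  rw [← hy] at hvar
  refine (ENNReal.toReal_le_of_le_ofReal (div_nonneg (variance_nonneg _ _) (sq_nonneg _))
    hcheb).trans ?_
  rw [div_le_iff₀ (by positivity)]
  refine hvar.trans ?_
  have h1 : M.bound (ε * τ) / N ≤ ε ^ 2 / 16 := by
    rw [div_le_iff₀ hNR]
    linarith
  calc M.bound (ε * τ) / N * (y + ε * τ) ^ 2 ≤ ε ^ 2 / 16 * (y + ε * τ) ^ 2 := by gcongr
    _ = 1 / 16 * (ε * (y + ε * τ)) ^ 2 := by ring

open Classical in
/-- The probability that the repetitions are too inaccurate at some point. -/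
theorem measure_bad_le (hV : VBounded M.fam M.ker M.bound D n)
    (hk : ∀ a b, M.ker a b ∈ Set.Icc (0 : ℝ) 1) (hx : Function.Injective M.pt)
    (hd : Metric.diam (Set.range M.pt) ≤ D) (h0 : ∀ i, 0 ≤ z i) (hz : ∑ i, z i = 1)
    (hε : 0 < ε) (ht : ε * τ ∈ Set.Ioc (0 : ℝ) 1) {m : ℕ}
    (hm : (n : ℝ) * (1 / 2) ^ m ≤ 1) (hn : 0 < n) :
    M.fam.tapeLaw (⋃ i : Fin n, {ω | m + 1 + (m + 1) ≤
      2 * (Finset.univ.filter fun r : Fin (m + 1 + (m + 1)) =>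
        ε * (truncated M z (m + 1) i + ε * τ) ≤ |repSum M ω z (m + 1)
          (sampleSize M.bound ε τ) i r - truncated M z (m + 1) i|).card}) ≤ (n : ENNReal)⁻¹ := by
  have hone (i : Fin n) := measure_half_le (μ := M.fam.tapeLaw)
    (fun (r : Fin (m + 1 + (m + 1))) ω => repSum M ω z (m + 1) (sampleSize M.bound ε τ) i r)
    (fun r => measurable_repSum z _ _ i r) (iIndepFun_repSum M z _ _ i)
    {x | ε * (truncated M z (m + 1) i + ε * τ) ≤ |x - truncated M z (m + 1) i|}
    (measurableSet_le measurable_const (by fun_prop))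
    (fun r => measure_repSum_le hV hk hx hd h0 hz hε ht (m + 1) i r)
  simp only [Set.mem_ofPred_eq] at hone
  have hnR : (0 : ℝ) < n := by exact_mod_cast hn
  have hreal := (measureReal_iUnion_fintype_le (μ := M.fam.tapeLaw) fun i : Fin n =>
    {ω | m + 1 + (m + 1) ≤
      2 * (Finset.univ.filter fun r : Fin (m + 1 + (m + 1)) =>
        ε * (truncated M z (m + 1) i + ε * τ) ≤ |repSum M ω z (m + 1)
          (sampleSize M.bound ε τ) i r - truncated M z (m + 1) i|).card}).trans
    (Finset.sum_le_sum fun i _ => hone i)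
  rw [Finset.sum_const, Finset.card_univ, Fintype.card_fin, nsmul_eq_mul] at hreal
  -- The depth `m` doubles as the logarithm needed for amplification, since `n ≤ 2^m`.
  have hpow : (n : ℝ) * (1 / 2) ^ (m + 1 + (m + 1)) ≤ (n : ℝ)⁻¹ := by
    rw [← one_div, le_div_iff₀ hnR]
    calc (n : ℝ) * (1 / 2) ^ (m + 1 + (m + 1)) * n = (n * (1 / 2) ^ m) ^ 2 / 4 := by ring
      _ ≤ 1 := by
        have : ((n : ℝ) * (1 / 2) ^ m) ^ 2 ≤ 1 := pow_le_one₀ (by positivity) hm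
        linarith
  rw [measureReal_def] at hreal
  rw [← ENNReal.ofReal_toReal (measure_ne_top M.fam.tapeLaw _)]
  refine (ENNReal.ofReal_le_ofReal (hreal.trans hpow)).trans_eq ?_
  rw [ENNReal.ofReal_inv_of_pos hnR, ENNReal.ofReal_natCast]

end Analysis

/-! ### Norms and running time -/

/-- Monotonicity and homogeneity of the norm, then Minkowski's inequality for the constant vector
`c` and `|y|`. -/
theorem lpNorm_sub_le {n : ℕ} {a y : Fin n → ℝ} {ε c : ℝ} (hε : 0 ≤ ε) (hc : 0 ≤ c)
    (h : ∀ i, |a i - y i| ≤ ε * c + ε * |y i|) {p : ℝ} (hp : 1 ≤ p) :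
    lpNorm p (a - y) ≤ ε * (c * (n : ℝ) ^ (1 / p) + lpNorm p y) := by
  have hp0 : 0 < p := by linarith
  have hscale (g : Fin n → ℝ) : lpNorm p (fun i => ε * g i) = ε * lpNorm p g := by
    simp only [lpNorm, abs_mul, abs_of_nonneg hε]
    simp only [Real.mul_rpow hε (abs_nonneg _)]
    rw [← Finset.mul_sum, Real.mul_rpow (by positivity)
      (Finset.sum_nonneg fun i _ => Real.rpow_nonneg (abs_nonneg _) _), ← Real.rpow_mul hε,
      mul_one_div_cancel hp0.ne', Real.rpow_one]
  have h1 : lpNorm p (a - y) ≤ lpNorm p (fun i => ε * (c + |y i|)) := by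
    refine Real.rpow_le_rpow (Finset.sum_nonneg fun i _ => Real.rpow_nonneg (abs_nonneg _) _)
      (Finset.sum_le_sum fun i _ => Real.rpow_le_rpow (abs_nonneg _) ?_ hp0.le) (by positivity)
    rw [abs_of_nonneg (by positivity : 0 ≤ ε * (c + |y i|))]
    simpa [mul_add] using h i
  have h2 : lpNorm p (fun i => c + |y i|) ≤ c * (n : ℝ) ^ (1 / p) + lpNorm p y := by
    refine (Real.Lp_add_le Finset.univ (fun _ => c) (fun i => |y i|) hp).trans_eq ?_
    simp only [abs_abs, Finset.sum_const, Finset.card_univ, Fintype.card_fin, nsmul_eq_mul,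
      abs_of_nonneg hc, lpNorm]
    rw [Real.mul_rpow (by positivity) (by positivity), ← Real.rpow_mul hc,
      mul_one_div_cancel hp0.ne', Real.rpow_one, mul_comm c]
  rw [hscale] at h1
  exact h1.trans (mul_le_mul_of_nonneg_left h2 hε)

/-- All factors are at least `1`, so each monomial is at most `L^2 N n T`, and the coefficients add
up to less than `1000`. The extra `n + 3` is the space of the input. -/
theorem steps_le {m N n T : ℕ} (hN : 0 < N) (hn : 0 < n) (hT : 0 < T) :
    m * 40 + N * 40 + (m + 1) * (n * 40 + (m + 1 + (m + 1)) *
        (N * (n * (T + 40) + T * n + 60) + 40) + 100) +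
      n * ((m + 1 + (m + 1)) * ((m + 1 + (m + 1)) * 40 + 60) + 40) + 60 + (n + 3) ≤
      1000 * ((m + 1) * (m + 1) * N * n * T) := by
  obtain ⟨L, hL⟩ : ∃ L, L = m + 1 := ⟨_, rfl⟩
  have hL1 : 1 ≤ L := by omega
  have hm : m ≤ L := by omega
  rw [← hL]
  set Q := L * L * N * n * T with hQ
  have a1 : L ≤ Q := by
    calc L = L * 1 * 1 * 1 * 1 := by ring
      _ ≤ Q := by rw [hQ]; gcongr <;> assumption
  have a2 : N ≤ Q := by
    calc N = 1 * 1 * N * 1 * 1 := by ring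
      _ ≤ Q := by rw [hQ]; gcongr <;> assumption
  have a3 : L * n ≤ Q := by
    calc L * n = L * 1 * 1 * n * 1 := by ring
      _ ≤ Q := by rw [hQ]; gcongr <;> assumption
  have a4 : L * L * N * n ≤ Q := by
    calc L * L * N * n = L * L * N * n * 1 := by ring
      _ ≤ Q := by rw [hQ]; gcongr; assumption
  have a5 : L * L * N ≤ Q := by
    calc L * L * N = L * L * N * 1 * 1 := by ring
      _ ≤ Q := by rw [hQ]; gcongr <;> assumption
  have a6 : L * L ≤ Q := by
    calc L * L = L * L * 1 * 1 * 1 := by ring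
      _ ≤ Q := by rw [hQ]; gcongr <;> assumption
  have a7 : L * L * n ≤ Q := by
    calc L * L * n = L * L * 1 * n * 1 := by ring
      _ ≤ Q := by rw [hQ]; gcongr <;> assumption
  have a8 : n ≤ Q := by
    calc n = 1 * 1 * 1 * n * 1 := by ring
      _ ≤ Q := by rw [hQ]; gcongr <;> assumption
  calc _ = m * 40 + N * 40 + 40 * (L * n) + 2 * Q + 80 * (L * L * N * n) + 2 * Q +
        120 * (L * L * N) + 80 * (L * L) + 100 * L + 160 * (L * L * n) + 120 * (L * n) + 40 * n +
        60 + (n + 3) := by rw [hQ]; ring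
    _ ≤ _ := by omega

theorem depth_le {n m : ℕ} {t : ℝ} (hn : 0 < n) (ht : t ∈ Set.Ioc (0 : ℝ) 1)
    (hm : ∀ k < m, t < n * (1 / 2) ^ k) : (m + 1 : ℝ) ≤ 3 * Real.log (2 * n / t) := by
  have hnR : (1 : ℝ) ≤ n := by exact_mod_cast hn
  have h1 : Real.log 2 ≤ Real.log (2 * n / t) := by
    refine Real.log_le_log two_pos ?_
    rw [le_div_iff₀ ht.1]
    nlinarith [ht.2]
  have h2 : m * Real.log 2 ≤ Real.log (2 * n / t) := by
    rcases m with _ | k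
    · simpa using (Real.log_nonneg one_le_two).trans h1
    · rw [← Real.log_pow]
      refine Real.log_le_log (by positivity) ?_
      rw [le_div_iff₀ ht.1]
      have h3 := hm k (Nat.lt_succ_self k)
      have h4 : (2 : ℝ) ^ k * (1 / 2) ^ k = 1 := by rw [← mul_pow]; norm_num
      calc (2 : ℝ) ^ (k + 1) * t ≤ 2 ^ (k + 1) * (n * (1 / 2) ^ k) := by gcongr
        _ = 2 * n * (2 ^ k * (1 / 2) ^ k) := by ring
        _ = 2 * n := by rw [h4, mul_one]
  -- Adding `h1` and `h2` gives the factor `2 / log 2 < 3`.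
  nlinarith [Real.log_two_gt_d9, (Nat.cast_nonneg m : (0 : ℝ) ≤ m)]

theorem sampleSize_le {V : ℝ → ℝ} {ε τ : ℝ} (hε : ε ∈ Set.Ioc (0 : ℝ) 1) (hV : 0 ≤ V (ε * τ)) :
    (sampleSize V ε τ : ℝ) ≤ 33 * (1 / ε ^ 2 * max 1 (V (ε * τ))) := by
  have h1 : (1 : ℝ) ≤ max 1 (V (ε * τ)) := le_max_left _ _
  have h2 : V (ε * τ) ≤ max 1 (V (ε * τ)) := le_max_right _ _
  have hε2 : 0 < ε ^ 2 := pow_pos hε.1 2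
  have h3 := (Nat.ceil_lt_add_one (a := 16 * (1 + V (ε * τ)) / (ε * ε))
    (div_nonneg (by linarith) (mul_self_nonneg ε))).le
  have h4 : (1 : ℝ) ≤ 1 / ε ^ 2 := by
    rw [le_div_iff₀ hε2, one_mul]
    exact pow_le_one₀ hε.1.le hε.2
  have h5 : 16 * (1 + V (ε * τ)) / (ε * ε) ≤ 32 * (1 / ε ^ 2 * max 1 (V (ε * τ))) := by
    rw [← sq, div_le_iff₀ hε2]
    have h6 : 32 * (1 / ε ^ 2 * max 1 (V (ε * τ))) * ε ^ 2 = 32 * max 1 (V (ε * τ)) := by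
      have := hε.1.ne'
      field_simp
    linarith
  -- The `1` lost to the ceiling turns `32` into `33`.
  refine h3.trans ?_
  nlinarith [mul_le_mul h4 h1 zero_le_one (zero_le_one.trans h4)]

theorem sampleSize_pos {V : ℝ → ℝ} {ε τ : ℝ} (hε : 0 < ε) (hV : 0 ≤ V (ε * τ)) :
    0 < sampleSize V ε τ :=
  Nat.ceil_pos.2 (div_pos (by linarith) (mul_pos hε hε))

theorem space_initState {E : Type w} {n : ℕ} (M : Env.{u, v, w} E n) (z : Fin n → ℝ) (ε τ : ℝ) :
    (initState M z ε τ).space ≤ n + 3 := by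
  have h1 := Finset.card_union_le ((Finset.range n).image fun i => (0, i))
    ({(1, 0), (1, 1)} : Finset (ℕ × ℕ))
  have h2 := Finset.card_image_le (s := Finset.range n) (f := fun i => (0, i))
  have h3 := Finset.card_le_two (a := ((1, 0) : ℕ × ℕ)) (b := (1, 1))
  rw [Finset.card_range] at h2
  simp only [State.space, initState, Finset.card_singleton, List.map_nil, List.sum_nil]
  omega

end KMV

end HBE

/-- One program, and one bound `B = C · log(2n/(ετ))^c · ε⁻² · V(ετ) · n · T` on time and space
(with `max 1 (V (ετ))` for `V (ετ)`), serve all hash families, kernels, datasets and weight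
vectors. -/
theorem theorem7p1 :
    ∃ (prog : HBE.Cmd) (C : ℝ) (c : ℕ),
      ∀ (d n : ℕ) (R : ℝ)
        (F : HBE.HashFamily (EuclideanSpace ℝ (Fin d)))
        (k : EuclideanSpace ℝ (Fin d) → EuclideanSpace ℝ (Fin d) → ℝ)
        (V : ℝ → ℝ) (T : ℕ)
        (x : Fin n → EuclideanSpace ℝ (Fin d)) (z : Fin n → ℝ) (ε τ : ℝ),
        (∀ a b, k a b ∈ Set.Icc (0 : ℝ) 1) →
        HBE.VBounded F k V R n →
        1 ≤ T →
        Function.Injective x →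
        Metric.diam (Set.range x) ≤ R →
        (∀ i, 0 ≤ z i) →
        ∑ i, |z i| = 1 →
        ε ∈ Set.Ioc (0 : ℝ) 1 →
        τ ∈ Set.Ioc (0 : ℝ) 1 →
        let M : HBE.Env (EuclideanSpace ℝ (Fin d)) n := ⟨F, k, V, T, x⟩
        let K : Matrix (Fin n) (Fin n) ℝ := Matrix.of fun i j => k (x i) (x j)
        let y : Fin n → ℝ := K.mulVec z
        let B : ℝ := C * Real.log (2 * n / (ε * τ)) ^ c *
          (1 / ε ^ 2 * max 1 (V (ε * τ)) * (n * T))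
        (∀ ω, ∃ s, HBE.Exec M ω prog (HBE.initState M z ε τ) s ∧
          (s.time : ℝ) ≤ B ∧ (s.space : ℝ) ≤ B) ∧
        F.tapeLaw {ω | ¬ ∃ s, HBE.Exec M ω prog (HBE.initState M z ε τ) s ∧
          (∀ i, |HBE.output s i - y i| ≤ 3 * ε * τ + ε * |y i|) ∧
          (∀ p : ℝ, 1 ≤ p → HBE.lpNorm p (HBE.output s - y) ≤
            ε * (3 * τ * (n : ℝ) ^ (1 / p) + HBE.lpNorm p y))}
          ≤ (n : ENNReal)⁻¹ := by
  classical
  -- `297000 = 1000 · 3^2 · 33`, from `steps_le`, `depth_le` and `sampleSize_le`; the two logarithms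
  -- count digits and repetitions.
  refine ⟨HBE.KMV.program, 297000, 2, ?_⟩
  intro d n R F k V T x z ε τ hk hV hT hx hd h0 habs hε hτ M K y B
  have hz : ∑ i, z i = 1 := by simpa [abs_of_nonneg (h0 _)] using habs
  have hn : 0 < n := by
    rcases Nat.eq_zero_or_pos n with rfl | h
    · simp at hz
    · exact h
  have h1 : ∀ i, z i ≤ 1 := fun i => by
    rw [← hz]
    exact Finset.single_le_sum (fun j _ => h0 j) (Finset.mem_univ i)
  have ht : ε * τ ∈ Set.Ioc (0 : ℝ) 1 :=
    ⟨mul_pos hε.1 hτ.1, mul_le_one₀ hε.2 hτ.1.le hτ.2⟩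
  have hVt := hV.nonneg _ ht
  have hex : ∃ m : ℕ, (n : ℝ) * (1 / 2) ^ m ≤ ε * τ := by
    have hnR : (0 : ℝ) < n := by exact_mod_cast hn
    obtain ⟨m, hm⟩ := exists_pow_lt_of_lt_one (div_pos ht.1 hnR) (by norm_num : (1 / 2 : ℝ) < 1)
    rw [lt_div_iff₀ hnR] at hm
    exact ⟨m, by linarith⟩
  obtain ⟨m, hm, hm'⟩ : ∃ m : ℕ, (n : ℝ) * (1 / 2) ^ m ≤ ε * τ ∧
      ∀ k < m, ε * τ < n * (1 / 2) ^ k :=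
    ⟨Nat.find hex, Nat.find_spec hex, fun k hk => not_le.1 (Nat.find_min hex hk)⟩
  have hB : (1000 * ((m + 1) * (m + 1) * HBE.KMV.sampleSize V ε τ * n * T) : ℝ) ≤ B := by
    have e1 := HBE.KMV.depth_le hn ht hm'
    have e2 := HBE.KMV.sampleSize_le hε hVt
    have e0 : 0 ≤ 3 * Real.log (2 * n / (ε * τ)) := le_trans (by positivity) e1
    have e3 : ((m : ℝ) + 1) * (m + 1) ≤
        3 * Real.log (2 * n / (ε * τ)) * (3 * Real.log (2 * n / (ε * τ))) := by gcongr
    have e4 := mul_nonneg e0 e0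
    calc (1000 * ((m + 1) * (m + 1) * HBE.KMV.sampleSize V ε τ * n * T) : ℝ)
        ≤ 1000 * (3 * Real.log (2 * n / (ε * τ)) * (3 * Real.log (2 * n / (ε * τ))) *
          (33 * (1 / ε ^ 2 * max 1 (V (ε * τ)))) * n * T) := by gcongr
      _ = B := by simp only [B]; ring
  have hrun (ω) := HBE.KMV.program_spec (M := M) (ω := ω) z ε τ m hm hm'
  have hsteps := HBE.KMV.steps_le (m := m) (HBE.KMV.sampleSize_pos (τ := τ) hε.1 hVt) hn hT
  refine ⟨fun ω => ?_, ?_⟩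
  · obtain ⟨s, hs, htime, -⟩ := hrun ω
    have hspace := hs.space_le
    have hinit := HBE.KMV.space_initState M z ε τ
    have htime0 : (HBE.initState M z ε τ).time = 0 := rfl
    have hle : s.time + (n + 3) ≤
        1000 * ((m + 1) * (m + 1) * HBE.KMV.sampleSize V ε τ * n * T) :=
      (Nat.add_le_add_right htime _).trans hsteps
    refine ⟨s, hs, le_trans ?_ hB, le_trans ?_ hB⟩
    · exact_mod_cast (by omega :
        s.time ≤ 1000 * ((m + 1) * (m + 1) * HBE.KMV.sampleSize V ε τ * n * T))
    · exact_mod_cast (by omega :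
        s.space ≤ 1000 * ((m + 1) * (m + 1) * HBE.KMV.sampleSize V ε τ * n * T))
  -- Monotonicity holds for all sets, so the failure event need not be measurable.
  · refine le_trans (MeasureTheory.measure_mono fun ω hω => ?_) (HBE.KMV.measure_bad_le (M := M) hV hk hx hd
      h0 hz hε.1 ht (hm.trans ht.2) hn)
    by_contra hgood
    simp only [Set.mem_iUnion, not_exists] at hgood
    refine hω ?_
    obtain ⟨s, hs, -, hsel⟩ := hrun ω
    have hpoint : ∀ i, |HBE.output s i - y i| ≤ 3 * ε * τ + ε * |y i| := fun i => by
      have hy' := HBE.KMV.truncated_nonneg (M := M) hk z (m + 1) i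
      have hδ := mul_nonneg hε.1.le (add_nonneg hy' ht.1.le)
      have g1 := abs_le.1 ((hsel i).abs_sub_le hy' hδ (not_le.1 (hgood i)))
      have g2 : HBE.KMV.truncated M z (m + 1) i ≤ y i :=
        HBE.KMV.truncated_le (M := M) hk h0 h1 (m + 1) i
      have g3 : y i ≤ HBE.KMV.truncated M z (m + 1) i + n * (1 / 2) ^ m :=
        HBE.KMV.le_truncated_add (M := M) hk h0 h1 m i
      have g4 : ε * HBE.KMV.truncated M z (m + 1) i ≤ ε * |y i| :=
        mul_le_mul_of_nonneg_left (g2.trans (le_abs_self _)) hε.1.le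
      have g5 : ε * (ε * τ) ≤ ε * τ := mul_le_of_le_one_left ht.1.le hε.2
      -- Sampling contributes `ε y' + ε^2 τ ≤ ε |y i| + ετ`, with `y'` the truncated product, and
      -- truncation contributes `ετ`, so `2ετ` would already do.
      rw [abs_le]
      constructor <;> linarith [g1.1, g1.2, ht.1]
    refine ⟨s, hs, hpoint, fun p hp => HBE.KMV.lpNorm_sub_le hε.1.le
      (by linarith [hτ.1]) (fun i => (hpoint i).trans_eq (by ring)) hp⟩
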